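/- Let $\Omega$ be a separable metric space with its Borel $\sigma$-algebra, let $\tau=(\tau_a)_{a\in\mathbb R}$ be a continuous action of $\mathbb R$ on $\Omega$, and let $\mathbb P$ be a $\tau$-invariant probability measure on $\Omega$ that is positive on nonempty open sets and ergodic (a Borel set $A$ with $\tau_aA=A$ for all $a$ has $\mathbb P(A)\in\{0,1\}$). Let $\bar K:\Omega\times[-1,1]\to\mathbb R$ be measurable, put $K(q,p;\omega)=\bar K(\tau_q\omega,p)$ for $(q,p)\in\mathcal S=\mathbb R\times[-1,1]$, and assume that $\bar K$ is $C^1$ in the sense that for almost every $\omega$ the function $K(\cdot,\cdot\,;\omega)$ is $C^1$ on $\mathcal S$, up to the boundary. Assume that, for almost every $\omega$, $K_p(q,1;\omega)<0$ and $K_p(q,-1;\omega)>0$ for all $q\in\mathbb R$ (in particular this holds if $\mp\bar K_p(\omega,\pm1)>0$ for every $\omega\in\Omega$). Call $(q,p)\in\mathcal S$ critical for $K(\cdot,\cdot\,;\omega)$ if $K_q=K_p=0$ there, and call a critical point a saddle point if it is neither a local maximum nor a local minimum of $K(\cdot,\cdot\,;\omega)$ on $\mathcal S$. Then: (a) almost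 surely $K(\cdot,\cdot\,;\omega)$ has infinitely many critical points; (b) one of the following holds: (1) almost surely $K(\cdot,\cdot\,;\omega)$ has a continuum of critical points, of the form $\{(q,a(q)) : q\in\mathbb R\}$ for some function $a=a_\omega:\mathbb R\to[-1,1]$ (not necessarily continuous); or (2) almost surely $K(\cdot,\cdot\,;\omega)$ has infinitely many critical points that are local maxima, and infinitely many critical points that are saddle points or local minima, and are not also local maxima. -/

import Mathlib

open Set MeasureTheory

namespace RandomTwist

/-- The strip `ℝ × [-1, 1]`, with coordinates `(q, p)`. -/
def strip : Set (ℝ × ℝ) := univ ×ˢ Icc (-1) 1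

/-- `P` is a `τ`-invariant ergodic probability measure that charges every nonempty open set;
`τ` is a continuous action of `ℝ` on `Ω`. -/
structure IsInvariantErgodic {Ω : Type*} [TopologicalSpace Ω] [MeasurableSpace Ω]
    (τ : Flow ℝ Ω) (P : Measure Ω) : Prop where
  prob : P univ = 1
  pos : ∀ U : Set Ω, IsOpen U → U.Nonempty → 0 < P U
  invariant : ∀ (a : ℝ) (A : Set Ω), MeasurableSet A → P (τ a '' A) = P A
  ergodic : ∀ A : Set Ω, MeasurableSet A → (∀ a : ℝ, τ a '' A = A) → P A = 1 ∨ P A = 0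

/-- The realization `K(q, p; ω) = Kbar(τ_q ω, p)`. Only the values of `Kbar` on `Ω × [-1, 1]`
are ever used, since realizations are only considered on the strip. -/
def realization {Ω : Type*} [TopologicalSpace Ω] (τ : Flow ℝ Ω) (Kbar : Ω → ℝ → ℝ) (ω : Ω) :
    ℝ × ℝ → ℝ :=
  fun x => Kbar (τ x.1 ω) x.2

/-- `Kbar : Ω × [-1, 1] → ℝ` is measurable and, for almost every `ω`, has continuous partial
derivatives in the direction of the flow and in `p`, up to the boundary: the realization is
`C¹` on the closed strip. -/
structure IsC1 {Ω : Type*} [TopologicalSpace Ω] [MeasurableSpace Ω]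
    (τ : Flow ℝ Ω) (P : Measure Ω) (Kbar : Ω → ℝ → ℝ) : Prop where
  measurable : Measurable fun x : Ω × Icc (-1 : ℝ) 1 => Kbar x.1 x.2
  contDiffOn : ∀ᵐ ω ∂P, ContDiffOn ℝ 1 (realization τ Kbar ω) strip

/-- `x` is a critical point of `f : ℝ × [-1, 1] → ℝ`. -/
def IsCritical (f : ℝ × ℝ → ℝ) (x : ℝ × ℝ) : Prop :=
  x ∈ strip ∧ HasFDerivWithinAt f (0 : ℝ × ℝ →L[ℝ] ℝ) strip x

/-- Critical points that are local maxima of `f` on the strip. -/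
def IsCriticalMax (f : ℝ × ℝ → ℝ) (x : ℝ × ℝ) : Prop :=
  IsCritical f x ∧ IsLocalMaxOn f strip x

/-- Critical points that are local minima of `f` on the strip. -/
def IsCriticalMin (f : ℝ × ℝ → ℝ) (x : ℝ × ℝ) : Prop :=
  IsCritical f x ∧ IsLocalMinOn f strip x

/-- Saddle points: critical points that are neither local maxima nor local minima. -/
def IsSaddle (f : ℝ × ℝ → ℝ) (x : ℝ × ℝ) : Prop :=
  IsCritical f x ∧ ¬ IsLocalMaxOn f strip x ∧ ¬ IsLocalMinOn f strip x

/-- `f` has a continuum of critical points, of the form `{(q, a(q)) | q ∈ ℝ}`. No continuity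
of `a` is asked for. -/
def HasContinuumOfCriticalPoints (f : ℝ × ℝ → ℝ) : Prop :=
  ∃ a : ℝ → ℝ, ∀ q : ℝ, IsCritical f (q, a q)

end RandomTwist

/-!
Let `M q` be the maximum of `K` over the line `{q} × [-1, 1]`, and let the slope of the line be the
least norm of the gradient of `K` on it. Both are stationary functionals of the flow, so by
ergodicity each is either almost surely constant in `q` or, by Poincaré recurrence, crosses a fixed
level on arbitrarily far lines, on either side. If `M` is constant, the maximum of every line is a
critical point; if the slope vanishes identically, every line carries a critical point. Both cases
give a continuum.

Otherwise there are `γ` and `A` such that valleys, in which `M < γ` somewhere between two lines with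
`γ < M ≤ A`, recur. A maximum over the region between two low lines enclosing a high one is a local
maximum. The line through the bottom of a valley separates two high points, so the mountain pass
level between them is critical, and not all the critical points at that level are local maxima;
the hypothesis on `K_p` at `p = ±1` keeps a gradient-like deformation inside the strip. Since the
strip is not compact, a function `φ q` is subtracted first, with `|φ'| ≤ max 0 (slope - δ)` and
`φ = 0` on the valley. This creates no critical point, and as the lines of slope above `2 * δ`
recur, it makes `K` low far away on both sides.
-/

namespace RandomTwist

open Filter Topology

/-! ### The strip and the gradient -/

lemma mem_strip {x : ℝ × ℝ} : x ∈ strip ↔ x.2 ∈ Icc (-1 : ℝ) 1 := by simp [strip]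

lemma convex_strip : Convex ℝ strip := convex_univ.prod (convex_Icc _ _)

lemma uniqueDiffOn_strip : UniqueDiffOn ℝ strip :=
  uniqueDiffOn_univ.prod (uniqueDiffOn_Icc (by norm_num))

/-- The nearest-point retraction of the plane onto the strip. -/
noncomputable def clamp (x : ℝ × ℝ) : ℝ × ℝ := (x.1, max (-1) (min 1 x.2))

lemma continuous_clamp : Continuous clamp := by unfold clamp; fun_prop

lemma clamp_mem (x : ℝ × ℝ) : clamp x ∈ strip := by simp [mem_strip, clamp]

lemma clamp_of_mem {x : ℝ × ℝ} (hx : x ∈ strip) : clamp x = x := by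
  rw [mem_strip] at hx
  simp [clamp, hx.1, hx.2]

/-- The gradient of `f` on the strip, with one-sided derivatives at the boundary. -/
noncomputable def grad (f : ℝ × ℝ → ℝ) (x : ℝ × ℝ) : ℝ × ℝ :=
  (fderivWithin ℝ f strip x (1, 0), fderivWithin ℝ f strip x (0, 1))

lemma fderivWithin_apply_eq_grad (f : ℝ × ℝ → ℝ) (x v : ℝ × ℝ) :
    fderivWithin ℝ f strip x v = v.1 * (grad f x).1 + v.2 * (grad f x).2 := by
  have hv : v = v.1 • ((1 : ℝ), (0 : ℝ)) + v.2 • ((0 : ℝ), (1 : ℝ)) := by ext <;> simp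
  conv_lhs => rw [hv, map_add, map_smul, map_smul]
  rfl

lemma grad_eq_zero_iff {f : ℝ × ℝ → ℝ} {x : ℝ × ℝ} :
    grad f x = 0 ↔ fderivWithin ℝ f strip x = 0 :=
  ⟨fun h => by ext <;> simp [fderivWithin_apply_eq_grad, h], fun h => by simp [grad, h]⟩

lemma isCritical_iff {f : ℝ × ℝ → ℝ} (hf : DifferentiableOn ℝ f strip) {x : ℝ × ℝ}
    (hx : x ∈ strip) : IsCritical f x ↔ grad f x = 0 := by
  rw [grad_eq_zero_iff]
  refine ⟨fun h => h.2.fderivWithin (uniqueDiffOn_strip x hx), fun h => ⟨hx, ?_⟩⟩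
  exact h ▸ (hf x hx).hasFDerivWithinAt

lemma continuousOn_grad {f : ℝ × ℝ → ℝ} (hf : ContDiffOn ℝ 1 f strip) :
    ContinuousOn (grad f) strip := by
  have h := hf.continuousOn_fderivWithin uniqueDiffOn_strip le_rfl
  exact (h.clm_apply continuousOn_const).prodMk (h.clm_apply continuousOn_const)

/-- `f` is `C¹` on the strip, with gradient pointing strictly inward along the boundary. -/
structure IsRegular (f : ℝ × ℝ → ℝ) : Prop where
  contDiffOn : ContDiffOn ℝ 1 f strip
  grad_top : ∀ q, (grad f (q, 1)).2 < 0
  grad_bot : ∀ q, 0 < (grad f (q, -1)).2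

namespace IsRegular

variable {f : ℝ × ℝ → ℝ}

lemma continuousOn (hf : IsRegular f) : ContinuousOn f strip := hf.contDiffOn.continuousOn

lemma differentiableOn (hf : IsRegular f) : DifferentiableOn ℝ f strip :=
  hf.contDiffOn.differentiableOn one_ne_zero

lemma continuousOn_grad (hf : IsRegular f) : ContinuousOn (grad f) strip :=
  RandomTwist.continuousOn_grad hf.contDiffOn

lemma isCritical_iff (hf : IsRegular f) {x : ℝ × ℝ} (hx : x ∈ strip) :
    IsCritical f x ↔ grad f x = 0 :=
  RandomTwist.isCritical_iff hf.differentiableOn hx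

end IsRegular

/-- The projected gradient: the displacement from `x` to the point of the strip nearest to
`x + grad f x`. Unlike the gradient itself it never leads out of the strip. -/
noncomputable def projGrad (f : ℝ × ℝ → ℝ) (x : ℝ × ℝ) : ℝ × ℝ := clamp (x + grad f x) - x

lemma add_projGrad_mem_strip (f : ℝ × ℝ → ℝ) (x : ℝ × ℝ) : x + projGrad f x ∈ strip := by
  simpa [projGrad] using clamp_mem _

lemma continuousOn_projGrad {f : ℝ × ℝ → ℝ} (hf : ContDiffOn ℝ 1 f strip) :
    ContinuousOn (projGrad f) strip :=
  (continuous_clamp.comp_continuousOn (continuousOn_id.add (continuousOn_grad hf))).sub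
    continuousOn_id

/-- The inward gradient at the boundary guarantees that clamping never annihilates the step. -/
lemma IsRegular.fderivWithin_projGrad_pos {f : ℝ × ℝ → ℝ} (hf : IsRegular f) {x : ℝ × ℝ}
    (hx : x ∈ strip) (hne : ¬ IsCritical f x) : 0 < fderivWithin ℝ f strip x (projGrad f x) := by
  rw [hf.isCritical_iff hx] at hne
  rw [fderivWithin_apply_eq_grad]
  obtain ⟨q, p⟩ := x
  obtain ⟨hp₁, hp₂⟩ : p ∈ Icc (-1 : ℝ) 1 := mem_strip.1 hx
  have htop : p = 1 → (grad f (q, p)).2 < 0 := fun h => h ▸ hf.grad_top q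
  have hbot : p = -1 → 0 < (grad f (q, p)).2 := fun h => h ▸ hf.grad_bot q
  simp only [projGrad, clamp]
  generalize grad f (q, p) = g at *
  obtain ⟨u, v⟩ := g
  have hv : v ≠ 0 → 0 < (max (-1) (min 1 (p + v)) - p) * v := by
    intro hv
    rcases hv.lt_or_gt with hneg | hpos
    · have : p ≠ -1 := fun h => (hbot h).not_gt hneg
      have : -1 < p := lt_of_le_of_ne hp₁ this.symm
      exact mul_pos_of_neg_of_neg (sub_neg.2 (max_lt this (min_lt_of_right_lt (by linarith)))) hneg
    · have : p ≠ 1 := fun h => (htop h).not_gt hpos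
      have : p < 1 := lt_of_le_of_ne hp₂ this
      exact mul_pos (sub_pos.2 (lt_max_of_lt_right (lt_min this (by linarith)))) hpos
  by_cases hv0 : v = 0
  · have : u ≠ 0 := fun h => hne (by simp [h, hv0])
    simpa [hv0] using mul_self_pos.2 this
  · have := hv hv0
    simp only [Prod.mk_add_mk, Prod.mk_sub_mk, add_sub_cancel_left]
    nlinarith [mul_self_nonneg u]

lemma IsRegular.isCritical_of_isLocalMaxOn {f : ℝ × ℝ → ℝ} (hf : IsRegular f) {x : ℝ × ℝ}
    (hx : x ∈ strip) (hmax : IsLocalMaxOn f strip x) : IsCritical f x := by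
  by_contra hne
  refine (hf.fderivWithin_projGrad_pos hx hne).not_ge ?_
  exact hmax.hasFDerivWithinAt_nonpos (hf.differentiableOn x hx).hasFDerivWithinAt
    (mem_posTangentConeAt_of_segment_subset
      (convex_strip.segment_subset hx (add_projGrad_mem_strip f x)))

/-! ### Maxima and slopes of vertical lines -/

/-- The maximum of `f` over the vertical segment `{q} × [-1, 1]`. -/
noncomputable def lineMax (f : ℝ × ℝ → ℝ) (q : ℝ) : ℝ := sSup ((fun p => f (q, p)) '' Icc (-1) 1)

/-- The least supremum norm of the gradient of `f` on the vertical segment `{q} × [-1, 1]`. -/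
noncomputable def lineSlope (f : ℝ × ℝ → ℝ) (q : ℝ) : ℝ :=
  sInf ((fun p => ‖grad f (q, p)‖) '' Icc (-1) 1)

section Lines

lemma continuousOn_vertical {X : Type*} [TopologicalSpace X] {g : ℝ × ℝ → X}
    (hg : ContinuousOn g strip) (q : ℝ) : ContinuousOn (fun p => g (q, p)) (Icc (-1) 1) :=
  hg.comp (by fun_prop) fun _ hp => mem_strip.2 hp

lemma image_vertical_comp_clamp {X : Type*} (g : ℝ × ℝ → X) (q : ℝ) :
    (fun p => g (clamp (q, p))) '' Icc (-1) 1 = (fun p => g (q, p)) '' Icc (-1) 1 :=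
  image_congr fun _ hp => congrArg g (clamp_of_mem (mem_strip.2 hp))

variable {f : ℝ × ℝ → ℝ}

lemma isGreatest_lineMax (hf : ContinuousOn f strip) (q : ℝ) :
    IsGreatest ((fun p => f (q, p)) '' Icc (-1) 1) (lineMax f q) :=
  (isCompact_Icc.image_of_continuousOn (continuousOn_vertical hf q)).isGreatest_sSup
    ((nonempty_Icc.2 (by norm_num)).image _)

lemma isLeast_lineSlope (hf : ContinuousOn (grad f) strip) (q : ℝ) :
    IsLeast ((fun p => ‖grad f (q, p)‖) '' Icc (-1) 1) (lineSlope f q) :=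
  (isCompact_Icc.image_of_continuousOn (continuousOn_vertical hf.norm q)).isLeast_sInf
    ((nonempty_Icc.2 (by norm_num)).image _)

lemma continuous_lineMax (hf : ContinuousOn f strip) : Continuous (lineMax f) := by
  have hg : Continuous fun x => f (clamp x) := hf.comp_continuous continuous_clamp clamp_mem
  have := isCompact_Icc.continuous_sSup (K := Icc (-1 : ℝ) 1)
    (f := fun q p => f (clamp (q, p))) hg
  simp only [image_vertical_comp_clamp] at this
  exact this

lemma continuous_lineSlope (hf : ContinuousOn (grad f) strip) : Continuous (lineSlope f) := by
  have hg : Continuous fun x => ‖grad f (clamp x)‖ :=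
    hf.norm.comp_continuous continuous_clamp clamp_mem
  have := isCompact_Icc.continuous_sInf (K := Icc (-1 : ℝ) 1)
    (f := fun q p => ‖grad f (clamp (q, p))‖) hg
  simp only [image_vertical_comp_clamp fun x => ‖grad f x‖] at this
  exact this

lemma le_lineMax (hf : ContinuousOn f strip) {x : ℝ × ℝ} (hx : x ∈ strip) :
    f x ≤ lineMax f x.1 :=
  (isGreatest_lineMax hf x.1).2 ⟨x.2, mem_strip.1 hx, rfl⟩

lemma exists_eq_lineMax (hf : ContinuousOn f strip) (q : ℝ) :
    ∃ x ∈ strip, x.1 = q ∧ f x = lineMax f q := by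
  obtain ⟨p, hp, h⟩ := (isGreatest_lineMax hf q).1
  exact ⟨(q, p), mem_strip.2 hp, rfl, h⟩

lemma lineMax_le_iff (hf : ContinuousOn f strip) {q α : ℝ} :
    lineMax f q ≤ α ↔ ∀ p ∈ Icc (-1 : ℝ) 1, f (q, p) ≤ α := by
  simpa only [upperBounds, forall_mem_image, mem_ofPred_eq] using
    isLUB_le_iff (isGreatest_lineMax hf q).isLUB (b := α)

lemma lineMax_sub_comp_fst (hf : ContinuousOn f strip) {φ : ℝ → ℝ} (hφ : Continuous φ) (q : ℝ) :
    lineMax (fun x => f x - φ x.1) q = lineMax f q - φ q := by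
  have hfφ : ContinuousOn (fun x => f x - φ x.1) strip := by fun_prop
  refine eq_of_forall_ge_iff fun α => ?_
  simp only [lineMax_le_iff hfφ, sub_le_iff_le_add, lineMax_le_iff hf]

lemma lineSlope_le (hf : ContinuousOn (grad f) strip) {x : ℝ × ℝ} (hx : x ∈ strip) :
    lineSlope f x.1 ≤ ‖grad f x‖ :=
  (isLeast_lineSlope hf x.1).2 ⟨x.2, mem_strip.1 hx, rfl⟩

lemma lineSlope_nonneg (hf : ContinuousOn (grad f) strip) (q : ℝ) : 0 ≤ lineSlope f q := by
  obtain ⟨p, -, h⟩ := (isLeast_lineSlope hf q).1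
  exact h ▸ norm_nonneg _

lemma le_lineSlope_iff (hf : ContinuousOn (grad f) strip) {q α : ℝ} :
    α ≤ lineSlope f q ↔ ∀ p ∈ Icc (-1 : ℝ) 1, α ≤ ‖grad f (q, p)‖ := by
  simpa only [lowerBounds, forall_mem_image, mem_ofPred_eq] using
    le_isGLB_iff (isLeast_lineSlope hf q).isGLB (b := α)

lemma IsRegular.exists_isCritical_of_lineSlope_eq_zero (hf : IsRegular f) {q : ℝ}
    (hq : lineSlope f q = 0) : ∃ p, IsCritical f (q, p) := by
  obtain ⟨p, hp, h⟩ := (isLeast_lineSlope hf.continuousOn_grad q).1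
  exact ⟨p, (hf.isCritical_iff (mem_strip.2 hp)).2 (norm_eq_zero.1 (h.trans hq))⟩

end Lines

/-! ### Continua of critical points -/

lemma HasContinuumOfCriticalPoints.infinite {f : ℝ × ℝ → ℝ}
    (hf : HasContinuumOfCriticalPoints f) : {x | IsCritical f x}.Infinite := by
  obtain ⟨a, ha⟩ := hf
  exact infinite_of_injective_forall_mem (fun q r h => congrArg Prod.fst h) ha

lemma IsRegular.hasContinuum_of_lineSlope_eq_zero {f : ℝ × ℝ → ℝ} (hf : IsRegular f)
    (hzero : ∀ q, lineSlope f q = 0) : HasContinuumOfCriticalPoints f := by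
  choose a ha using fun q => hf.exists_isCritical_of_lineSlope_eq_zero (hzero q)
  exact ⟨a, ha⟩

lemma IsRegular.hasContinuum_of_lineMax_eq_const {f : ℝ × ℝ → ℝ} (hf : IsRegular f) {c : ℝ}
    (hc : ∀ q, lineMax f q = c) : HasContinuumOfCriticalPoints f := by
  have hcrit : ∀ q, ∃ p, IsCritical f (q, p) := by
    intro q
    obtain ⟨⟨q, p⟩, hx, rfl, hmax⟩ := exists_eq_lineMax hf.continuousOn q
    refine ⟨p, hf.isCritical_of_isLocalMaxOn hx ?_⟩
    filter_upwards [self_mem_nhdsWithin] with y hy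
    exact (le_lineMax hf.continuousOn hy).trans_eq ((hc _).trans ((hc _).symm.trans hmax.symm))
  choose a ha using hcrit
  exact ⟨a, ha⟩

/-! ### Minimax levels -/

section Minimax

variable {X : Type*} [TopologicalSpace X]

lemma isClosed_connectedComponentIn {F : Set X} (hF : IsClosed F) (x : X) :
    IsClosed (connectedComponentIn F x) := by
  rcases (connectedComponentIn F x).eq_empty_or_nonempty with hempty | hne
  · exact hempty ▸ isClosed_empty
  · have hx : x ∈ connectedComponentIn F x :=
      mem_connectedComponentIn (connectedComponentIn_nonempty_iff.1 hne)
    exact isClosed_of_closure_subset (isPreconnected_connectedComponentIn.closure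
      |>.subset_connectedComponentIn (subset_closure hx)
        (closure_minimal (connectedComponentIn_subset F x) hF))

variable [T2Space X]

lemma isPreconnected_iInter_of_directed {ι : Type*} [Nonempty ι] {C : ι → Set X}
    (hC : Directed (· ⊇ ·) C) (hcomp : ∀ i, IsCompact (C i))
    (hconn : ∀ i, IsPreconnected (C i)) : IsPreconnected (⋂ i, C i) := by
  have hclosed : IsClosed (⋂ i, C i) := isClosed_iInter fun i => (hcomp i).isClosed
  have hcpt : IsCompact (⋂ i, C i) :=
    (hcomp (Classical.arbitrary ι)).of_isClosed_subset hclosed (iInter_subset _ _)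
  rw [isPreconnected_iff_subset_of_disjoint_closed]
  intro u v hu hv huv hdisj
  obtain ⟨U, V, hU, hV, huU, hvV, hUV⟩ :
      SeparatedNhds ((⋂ i, C i) ∩ u) ((⋂ i, C i) ∩ v) := by
    apply SeparatedNhds.of_isCompact_isCompact (hcpt.inter_right hu) (hcpt.inter_right hv)
    rw [disjoint_iff_inter_eq_empty, ← inter_inter_distrib_left, hdisj]
  have hsub : ⋂ i, C i ⊆ U ∪ V := fun x hx =>
    (huv hx).imp (fun h => huU ⟨hx, h⟩) fun h => hvV ⟨hx, h⟩
  obtain ⟨i, hi⟩ := exists_subset_nhds_of_isCompact hC hcomp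
    fun x hx => (hU.union hV).mem_nhds (hsub hx)
  rcases isPreconnected_iff_subset_of_disjoint.1 (hconn i) U V hU hV hi
    (by rw [hUV.inter_eq, inter_empty]) with h | h
  · exact Or.inl fun x hx => (huv hx).resolve_right fun hxv =>
      disjoint_left.1 hUV (h (mem_iInter.1 hx i)) (hvV ⟨hx, hxv⟩)
  · exact Or.inr fun x hx => (huv hx).resolve_left fun hxu =>
      disjoint_left.1 hUV (huU ⟨hx, hxu⟩) (h (mem_iInter.1 hx i))

/-- A greatest level exists because the components of `x` in the superlevel sets below it form a
chain of compact connected sets, whose intersection is again connected. -/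
lemma exists_isGreatest_joining_level {α : Type*} [ConditionallyCompleteLinearOrder α]
    [DenselyOrdered α] [NoMinOrder α] [TopologicalSpace α] [ClosedIciTopology α]
    {B : Set X} (hB : IsCompact B) {f : X → α}
    (hf : ContinuousOn f B) {x y : X}
    (hne : ∃ t, y ∈ connectedComponentIn (B ∩ f ⁻¹' Ici t) x) :
    ∃ T, IsGreatest {t | y ∈ connectedComponentIn (B ∩ f ⁻¹' Ici t) x} T := by
  set J := {t | y ∈ connectedComponentIn (B ∩ f ⁻¹' Ici t) x}
  have hclosed (t : α) : IsClosed (B ∩ f ⁻¹' Ici t) :=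
    hf.preimage_isClosed_of_isClosed hB.isClosed isClosed_Ici
  have hanti : Antitone fun t => connectedComponentIn (B ∩ f ⁻¹' Ici t) x := fun s t hst =>
    connectedComponentIn_mono _ (inter_subset_inter_right _ (preimage_mono (Ici_subset_Ici.2 hst)))
  have hbdd : BddAbove J := ⟨f y, fun t ht => (connectedComponentIn_subset _ _ ht).2⟩
  refine ⟨sSup J, ?_, fun t ht => le_csSup hbdd ht⟩
  have hlt (t : Iio (sSup J)) : y ∈ connectedComponentIn (B ∩ f ⁻¹' Ici (t : α)) x := by
    obtain ⟨s, hs, hts⟩ := exists_lt_of_lt_csSup hne t.2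
    exact hanti hts.le hs
  have hx (t : Iio (sSup J)) : x ∈ connectedComponentIn (B ∩ f ⁻¹' Ici (t : α)) x :=
    mem_connectedComponentIn (connectedComponentIn_nonempty_iff.1 ⟨y, hlt t⟩)
  have hconn : IsPreconnected
      (⋂ t : Iio (sSup J), connectedComponentIn (B ∩ f ⁻¹' Ici (t : α)) x) :=
    isPreconnected_iInter_of_directed
      (hanti.comp_monotone (Subtype.mono_coe _)).directed_ge
      (fun t => hB.of_isClosed_subset (isClosed_connectedComponentIn (hclosed t) x)
        ((connectedComponentIn_subset _ _).trans inter_subset_left))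
      fun t => isPreconnected_connectedComponentIn
  refine hconn.subset_connectedComponentIn (mem_iInter.2 hx) (fun z hz => ?_) (mem_iInter.2 hlt)
  have hz' (t : Iio (sSup J)) := connectedComponentIn_subset _ _ (mem_iInter.1 hz t)
  exact ⟨(hz' (Classical.arbitrary _)).1,
    le_of_forall_lt_imp_le_of_dense fun t ht => (hz' ⟨t, ht⟩).2⟩

end Minimax

/-! ### Deformation along an ascending field -/

lemma eventually_forall_mem_of_isCompact {ι X : Type*} [TopologicalSpace X] {l : Filter ι}
    {C : Set X} (hC : IsCompact C) {Q : ι → X → Prop}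
    (hQ : ∀ y ∈ C, ∀ᶠ z in l ×ˢ 𝓝[C] y, Q z.1 z.2) : ∀ᶠ s in l, ∀ z ∈ C, Q s z := by
  refine hC.induction_on (p := fun D => ∀ᶠ s in l, ∀ z ∈ D, Q s z) (by simp)
    (fun D D' hDD' h => h.mono fun s hs z hz => hs z (hDD' hz))
    (fun D D' h h' => ?_) fun y hy => ?_
  · filter_upwards [h, h'] with s hs hs' z hz
    exact hz.elim (hs z) (hs' z)
  · obtain ⟨P, hP, R, hR, hPR⟩ := eventually_prod_iff.1 (hQ y hy)
    exact ⟨{z | R z}, hR, hP.mono fun s hs z hz => hPR hs hz⟩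

section Deformation

variable {E : Type*} [NormedAddCommGroup E] [NormedSpace ℝ E] {S C : Set E} {f : E → ℝ}
  {w : E → E}

lemma tendsto_add_smul_nhdsWithin (hS : Convex ℝ S) (hCS : C ⊆ S) (hw : ContinuousOn w C)
    (hstep : ∀ z ∈ C, z + w z ∈ S) {y : E} (hy : y ∈ C) :
    Tendsto (fun z : ℝ × E => z.2 + z.1 • w z.2) (𝓝[>] 0 ×ˢ 𝓝[C] y) (𝓝[S] y) := by
  have hs : Tendsto (fun z : ℝ × E => z.1) (𝓝[>] 0 ×ˢ 𝓝[C] y) (𝓝 0) :=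
    tendsto_fst.mono_right nhdsWithin_le_nhds
  have hz : Tendsto (fun z : ℝ × E => z.2) (𝓝[>] 0 ×ˢ 𝓝[C] y) (𝓝 y) :=
    tendsto_snd.mono_right nhdsWithin_le_nhds
  refine tendsto_nhdsWithin_iff.2
    ⟨by simpa using hz.add (hs.smul ((hw y hy).tendsto.comp tendsto_snd)), ?_⟩
  have hIoc : ∀ᶠ s : ℝ in 𝓝[>] 0, s ∈ Ioc 0 1 := Ioc_mem_nhdsGT one_pos
  filter_upwards [hIoc.prod_mk self_mem_nhdsWithin] with z ⟨hs, hz⟩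
  exact hS.add_smul_mem (hCS hz) (hstep _ hz) (Ioc_subset_Icc_self hs)

lemma eventually_lt_add_smul (hS : Convex ℝ S) (hS' : UniqueDiffOn ℝ S)
    (hf : ContDiffOn ℝ 1 f S) (hCS : C ⊆ S) (hw : ContinuousOn w C)
    (hstep : ∀ z ∈ C, z + w z ∈ S) {y : E} (hy : y ∈ C)
    (hpos : 0 < fderivWithin ℝ f S y (w y)) :
    ∀ᶠ z : ℝ × E in 𝓝[>] 0 ×ˢ 𝓝[C] y, f z.2 < f (z.2 + z.1 • w z.2) := by
  have hcont : ContinuousOn (fun u : E × E => fderivWithin ℝ f S u.1 (w u.2)) (S ×ˢ C) :=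
    ((hf.continuousOn_fderivWithin hS' le_rfl).comp continuousOn_fst fun u hu => hu.1).clm_apply
      (hw.comp continuousOn_snd fun u hu => hu.2)
  have hev := (hcont (y, y) ⟨hCS hy, hy⟩).eventually (lt_mem_nhds hpos)
  rw [nhdsWithin_prod_eq] at hev
  obtain ⟨P, hP, R, hR, hPR⟩ := eventually_prod_iff.1 hev
  obtain ⟨r, hr, hball⟩ := Metric.mem_nhdsWithin_iff.1 hP
  have hballC : ∀ᶠ z in 𝓝[C] y, z ∈ C ∩ Metric.ball y r :=
    inter_mem self_mem_nhdsWithin (mem_nhdsWithin_of_mem_nhds (Metric.ball_mem_nhds y hr))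
  have hballS : ∀ᶠ z in 𝓝[S] y, z ∈ S ∩ Metric.ball y r :=
    inter_mem self_mem_nhdsWithin (mem_nhdsWithin_of_mem_nhds (Metric.ball_mem_nhds y hr))
  filter_upwards [(tendsto_add_smul_nhdsWithin hS hCS hw hstep hy).eventually hballS,
    (eventually_mem_nhdsWithin (a := (0 : ℝ)) (s := Ioi 0)).prod_mk (hballC.and hR)]
    with ⟨s, z⟩ ⟨hS₁, hr₁⟩ ⟨hs, ⟨hzC, hr₀⟩, hRz⟩
  obtain ⟨u, hu, hmv⟩ := domain_mvt
    (fun x hx => (hf.differentiableOn one_ne_zero x hx).hasFDerivWithinAt) hS (hCS hzC) hS₁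
  have hPu : P u := hball ⟨(convex_ball y r).segment_subset hr₀ hr₁ hu,
    hS.segment_subset (hCS hzC) hS₁ hu⟩
  rw [add_sub_cancel_left, map_smul, smul_eq_mul] at hmv
  exact sub_pos.1 (hmv ▸ mul_pos hs (hPR hPu hRz))

lemma eventually_forall_lt_add_smul (hS : Convex ℝ S) (hS' : UniqueDiffOn ℝ S)
    (hf : ContDiffOn ℝ 1 f S) (hC : IsCompact C) (hCS : C ⊆ S) (hw : ContinuousOn w C)
    (hstep : ∀ z ∈ C, z + w z ∈ S) {t : ℝ} (hCt : ∀ z ∈ C, t ≤ f z)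
    (hpos : ∀ z ∈ C, f z = t → 0 < fderivWithin ℝ f S z (w z)) :
    ∀ᶠ s : ℝ in 𝓝[>] 0, ∀ z ∈ C, t < f (z + s • w z) := by
  refine eventually_forall_mem_of_isCompact hC fun y hy => ?_
  rcases (hCt y hy).eq_or_lt with heq | hlt
  · have hC' : ∀ᶠ z : ℝ × E in 𝓝[>] 0 ×ˢ 𝓝[C] y, z.2 ∈ C :=
      tendsto_snd.eventually self_mem_nhdsWithin
    filter_upwards [eventually_lt_add_smul hS hS' hf hCS hw hstep hy (hpos y hy heq.symm), hC']
      with z hz hzC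
    exact (hCt _ hzC).trans_lt hz
  · exact (tendsto_add_smul_nhdsWithin hS hCS hw hstep hy).eventually
      ((hf.continuousOn y (hCS hy)).eventually (lt_mem_nhds hlt))

end Deformation

/-! ### The mountain pass -/

/-- Being a critical point at the lowest level `T` is both a closed and an open condition. -/
lemma IsRegular.not_isCritical_of_forall_isLocalMaxOn {f : ℝ × ℝ → ℝ} (hf : IsRegular f)
    {C : Set (ℝ × ℝ)} (hC : IsPreconnected C) (hCs : C ⊆ strip) {T : ℝ} (hT : ∀ z ∈ C, T ≤ f z)
    (hmax : ∀ z ∈ C, IsCritical f z → IsLocalMaxOn f strip z) {x : ℝ × ℝ} (hx : x ∈ C)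
    (hxT : T < f x) {z : ℝ × ℝ} (hz : z ∈ C) (hzT : f z = T) : ¬ IsCritical f z := by
  intro hcrit
  have hiff : (f z, grad f z) = (T, 0) ↔ (f x, grad f x) = (T, 0) := by
    refine hC.induction₂ (fun u v => (f u, grad f u) = (T, 0) ↔ (f v, grad f v) = (T, 0))
      (fun u hu => ?_) (fun _ _ _ _ _ _ => Iff.trans) (fun _ _ _ _ => Iff.symm) hz hx
    by_cases hu₀ : (f u, grad f u) = (T, 0)
    · obtain ⟨huT, hgrad⟩ := Prod.mk.inj hu₀
      have hlocal : ∀ᶠ v in 𝓝[C] u, ∀ᶠ y in 𝓝[strip] v, f y ≤ T := by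
        have h := hmax u hu ((hf.isCritical_iff (hCs hu)).2 hgrad)
        rw [IsLocalMaxOn, IsMaxFilter, huT, ← eventually_eventually_nhdsWithin] at h
        exact h.filter_mono (nhdsWithin_mono u hCs)
      filter_upwards [hlocal, self_mem_nhdsWithin] with v hv hvC
      have hvT : f v = T := le_antisymm (hv.self_of_nhdsWithin (hCs hvC)) (hT v hvC)
      have hvmax : IsLocalMaxOn f strip v := hv.mono fun y hy => hy.trans_eq hvT.symm
      have hvgrad := (hf.isCritical_iff (hCs hvC)).1
        (hf.isCritical_of_isLocalMaxOn (hCs hvC) hvmax)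
      simp only [hu₀, hvT, hvgrad]
    · have hcont := (hf.continuousOn.prodMk hf.continuousOn_grad).mono hCs u hu
      filter_upwards [hcont.eventually_ne hu₀] with v hv
      exact iff_of_false hu₀ hv
  have := hiff.1 (Prod.ext hzT ((hf.isCritical_iff (hCs hz)).1 hcrit))
  exact hxT.ne' (congrArg Prod.fst this)

/-- One step along the projected gradient, cut off near the endpoints, lifts `C`. -/
lemma IsRegular.exists_lift {f : ℝ × ℝ → ℝ} (hf : IsRegular f) {C : Set (ℝ × ℝ)}
    (hC : IsCompact C) (hconn : IsPreconnected C) (hCs : C ⊆ strip) {T : ℝ}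
    (hT : ∀ z ∈ C, T ≤ f z) (hcrit : ∀ z ∈ C, f z = T → ¬ IsCritical f z) {x y : ℝ × ℝ}
    (hx : x ∈ C) (hxT : T < f x) (hy : y ∈ C) (hyT : T < f y) :
    ∃ D ⊆ strip, IsCompact D ∧ IsPreconnected D ∧ x ∈ D ∧ y ∈ D ∧ ∀ z ∈ D, T < f z := by
  set h := min (f x) (f y)
  have hTh : T < h := lt_min hxT hyT
  set θ : ℝ × ℝ → ℝ := fun z => max 0 (min 1 (h - f z))
  have hθ (z : ℝ × ℝ) : θ z ∈ Icc 0 1 := ⟨le_max_left _ _, max_le zero_le_one (min_le_left _ _)⟩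
  have hθ₀ {z : ℝ × ℝ} (hz : h ≤ f z) : θ z = 0 :=
    max_eq_left (min_le_of_right_le (sub_nonpos.2 hz))
  have hθT {z : ℝ × ℝ} (hz : f z = T) : 0 < θ z :=
    lt_max_of_lt_right (lt_min one_pos (by linarith))
  set w : ℝ × ℝ → ℝ × ℝ := fun z => θ z • projGrad f z
  have hwc : ContinuousOn w C := by
    have hfC := hf.continuousOn.mono hCs
    have hgC := (continuousOn_projGrad hf.contDiffOn).mono hCs
    fun_prop
  have hstep : ∀ z ∈ C, z + w z ∈ strip := fun z hz =>
    convex_strip.add_smul_mem (hCs hz) (add_projGrad_mem_strip f z) (hθ z)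
  have hpos : ∀ z ∈ C, f z = T → 0 < fderivWithin ℝ f strip z (w z) := by
    intro z hz hzT
    rw [map_smul, smul_eq_mul]
    exact mul_pos (hθT hzT) (hf.fderivWithin_projGrad_pos (hCs hz) (hcrit z hz hzT))
  have hup := eventually_forall_lt_add_smul convex_strip uniqueDiffOn_strip hf.contDiffOn hC hCs
    hwc hstep hT hpos
  obtain ⟨s, hs, hs₀, hs₁⟩ := (hup.and (Ioc_mem_nhdsGT (zero_lt_one' ℝ))).exists
  have hηc : ContinuousOn (fun z => z + s • w z) C := continuousOn_id.add (hwc.const_smul s)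
  refine ⟨(fun z => z + s • w z) '' C, ?_, hC.image_of_continuousOn hηc, hconn.image _ hηc,
    ⟨x, hx, ?_⟩, ⟨y, hy, ?_⟩, forall_mem_image.2 hs⟩
  · exact image_subset_iff.2 fun z hz =>
      convex_strip.add_smul_mem (hCs hz) (hstep z hz) ⟨hs₀.le, hs₁⟩
  · simp [w, hθ₀ (min_le_left _ _ : h ≤ f x)]
  · simp [w, hθ₀ (min_le_right _ _ : h ≤ f y)]

lemma fst_mem_Ioo_of_isPreconnected {f : ℝ × ℝ → ℝ} (hf : ContinuousOn f strip)
    {D : Set (ℝ × ℝ)} (hD : IsPreconnected D) (hDs : D ⊆ strip) {A a b : ℝ}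
    (hA : ∀ z ∈ D, A ≤ f z) (ha : lineMax f a < A) (hb : lineMax f b < A) {x : ℝ × ℝ}
    (hx : x ∈ D) (hxab : x.1 ∈ Ioo a b) {z : ℝ × ℝ} (hz : z ∈ D) : z.1 ∈ Ioo a b := by
  have hord := (hD.image Prod.fst continuous_fst.continuousOn).ordConnected
  have hfst {q : ℝ} (hq : lineMax f q < A) : q ∉ Prod.fst '' D := by
    rintro ⟨y, hy, rfl⟩
    exact ((hA y hy).trans (le_lineMax hf (hDs hy))).not_gt hq
  constructor
  · by_contra! hza
    exact hfst ha (hord.out ⟨z, hz, rfl⟩ ⟨x, hx, rfl⟩ ⟨hza, hxab.1.le⟩)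
  · by_contra! hzb
    exact hfst hb (hord.out ⟨x, hx, rfl⟩ ⟨z, hz, rfl⟩ ⟨hxab.2.le, hzb⟩)

/-- Between `q₁` and `q₂`, where `f` is at least `A`, the line over `q₀`, on which `f` is at most
`γ`, separates two points, over `q₁` and over `q₂`, at which `f` is greater than `γ`. -/
structure IsValley (f : ℝ × ℝ → ℝ) (γ A q₁ q₀ q₂ : ℝ) : Prop where
  le_left : q₁ ≤ q₀
  le_right : q₀ ≤ q₂
  high_left : γ < lineMax f q₁
  low : lineMax f q₀ ≤ γ
  high_right : γ < lineMax f q₂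
  bound : ∀ x ∈ Icc q₁ q₂ ×ˢ Icc (-1 : ℝ) 1, A ≤ f x

/-- The level `T` is the highest one above which the two sides of the valley are connected. -/
lemma IsValley.exists_minimax {f : ℝ × ℝ → ℝ} {γ A : ℝ} {x₁ x₂ : ℝ × ℝ} {q₀ : ℝ}
    (hV : IsValley f γ A x₁.1 q₀ x₂.1) (hf : ContinuousOn f strip) (hx₁ : x₁ ∈ strip)
    (hx₂ : x₂ ∈ strip) {a b : ℝ} (ha : a ≤ x₁.1) (hb : x₂.1 ≤ b) :
    ∃ T ∈ Icc A γ,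
      (∃ C ⊆ strip, IsCompact C ∧ IsPreconnected C ∧ x₁ ∈ C ∧ x₂ ∈ C ∧ ∀ z ∈ C, T ≤ f z) ∧
      ∀ D ⊆ Icc a b ×ˢ Icc (-1) 1, IsCompact D → IsPreconnected D → x₁ ∈ D → x₂ ∈ D →
        ∃ z ∈ D, f z ≤ T := by
  have h₁₂ := hV.le_left.trans hV.le_right
  set B : Set (ℝ × ℝ) := Icc a b ×ˢ Icc (-1) 1
  have hB : IsCompact B := isCompact_Icc.prod isCompact_Icc
  have hBs : B ⊆ strip := prod_mono (subset_univ _) subset_rfl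
  set R : Set (ℝ × ℝ) := Icc x₁.1 x₂.1 ×ˢ Icc (-1) 1
  have hR : x₂ ∈ connectedComponentIn (B ∩ f ⁻¹' Ici A) x₁ :=
    (isPreconnected_Icc.prod isPreconnected_Icc).subset_connectedComponentIn
      (s := R) ⟨⟨le_rfl, h₁₂⟩, hx₁.2⟩
      (subset_inter (prod_mono (Icc_subset_Icc ha hb) subset_rfl) hV.bound)
      ⟨⟨h₁₂, le_rfl⟩, hx₂.2⟩
  obtain ⟨T, hTmem, hTmax⟩ := exists_isGreatest_joining_level hB (hf.mono hBs) ⟨A, hR⟩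
  set C := connectedComponentIn (B ∩ f ⁻¹' Ici T) x₁
  have hCconn : IsPreconnected C := isPreconnected_connectedComponentIn
  have hCsub : C ⊆ B ∩ f ⁻¹' Ici T := connectedComponentIn_subset _ _
  have hx₁C : x₁ ∈ C := mem_connectedComponentIn (connectedComponentIn_nonempty_iff.1 ⟨x₂, hTmem⟩)
  have hC : IsCompact C := hB.of_isClosed_subset (isClosed_connectedComponentIn
    ((hf.mono hBs).preimage_isClosed_of_isClosed hB.isClosed isClosed_Ici) x₁)
    (hCsub.trans inter_subset_left)
  have hTγ : T ≤ γ := by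
    obtain ⟨z, hz, rfl⟩ := (hCconn.image Prod.fst continuous_fst.continuousOn).ordConnected.out
      ⟨x₁, hx₁C, rfl⟩ ⟨x₂, hTmem, rfl⟩ ⟨hV.le_left, hV.le_right⟩
    exact (hCsub hz).2.trans ((le_lineMax hf (hBs (hCsub hz).1)).trans hV.low)
  refine ⟨T, ⟨hTmax hR, hTγ⟩, ⟨C, hCsub.trans (inter_subset_left.trans hBs), hC, hCconn, hx₁C,
    hTmem, fun z hz => (hCsub hz).2⟩, fun D hDB hD hDconn hx₁D hx₂D => ?_⟩
  obtain ⟨z₀, hz₀, hmin⟩ := hD.exists_isMinOn ⟨x₁, hx₁D⟩ (hf.mono (hDB.trans hBs))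
  exact ⟨z₀, hz₀, hTmax (hDconn.subset_connectedComponentIn hx₁D (subset_inter hDB hmin) hx₂D)⟩

/-- **Mountain pass.** If all critical points between the lines over `a` and `b` were local maxima,
there would be none at the minimax level, and the connected set could be pushed above it. -/
theorem IsValley.exists_isCritical_not_isLocalMaxOn {f : ℝ × ℝ → ℝ} {γ A q₁ q₀ q₂ : ℝ}
    (hV : IsValley f γ A q₁ q₀ q₂) (hf : IsRegular f) {a b : ℝ} (haq : a < q₁) (hqb : q₂ < b)
    (ha : lineMax f a < A) (hb : lineMax f b < A) :
    ∃ x, x.1 ∈ Ioo a b ∧ IsCritical f x ∧ ¬ IsLocalMaxOn f strip x := by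
  by_contra! hmax
  obtain ⟨x₁, hx₁s, rfl, hx₁⟩ := exists_eq_lineMax hf.continuousOn q₁
  obtain ⟨x₂, hx₂s, rfl, hx₂⟩ := exists_eq_lineMax hf.continuousOn q₂
  obtain ⟨T, ⟨hAT, hTγ⟩, ⟨C, hCs, hC, hCconn, hx₁C, hx₂C, hTC⟩, hT⟩ :=
    hV.exists_minimax hf.continuousOn hx₁s hx₂s haq.le hqb.le
  have hIoo : ∀ D ⊆ strip, IsPreconnected D → x₁ ∈ D → (∀ z ∈ D, T ≤ f z) →
      ∀ z ∈ D, z.1 ∈ Ioo a b := fun D hDs hD hx₁D hTD z =>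
    fst_mem_Ioo_of_isPreconnected hf.continuousOn hD hDs (fun z hz => hAT.trans (hTD z hz)) ha hb
      hx₁D ⟨haq, (hV.le_left.trans hV.le_right).trans_lt hqb⟩
  have hx₁T : T < f x₁ := hx₁ ▸ hTγ.trans_lt hV.high_left
  have hx₂T : T < f x₂ := hx₂ ▸ hTγ.trans_lt hV.high_right
  have hcrit : ∀ z ∈ C, f z = T → ¬ IsCritical f z := fun z =>
    hf.not_isCritical_of_forall_isLocalMaxOn hCconn hCs hTC
      (fun z hz => hmax z (hIoo C hCs hCconn hx₁C hTC z hz)) hx₁C hx₁T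
  obtain ⟨D, hDs, hD, hDconn, hx₁D, hx₂D, hTD⟩ :=
    hf.exists_lift hC hCconn hCs hTC hcrit hx₁C hx₁T hx₂C hx₂T
  have hDB : D ⊆ Icc a b ×ˢ Icc (-1) 1 := fun z hz => ⟨Ioo_subset_Icc_self
    (hIoo D hDs hDconn hx₁D (fun z hz => (hTD z hz).le) z hz), mem_strip.1 (hDs hz)⟩
  obtain ⟨z, hz, hzT⟩ := hT D hDB hD hDconn hx₁D hx₂D
  exact (hTD z hz).not_ge hzT

/-! ### Subtracting a function of the first coordinate -/

section SubCompFst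

variable {f : ℝ × ℝ → ℝ} {φ : ℝ → ℝ}

lemma grad_sub_comp_fst {x : ℝ × ℝ} (hx : x ∈ strip) (hf : DifferentiableWithinAt ℝ f strip x)
    (hφ : DifferentiableAt ℝ φ x.1) :
    grad (fun y => f y - φ y.1) x = grad f x - (deriv φ x.1, 0) := by
  have hφ' : HasFDerivWithinAt (fun y : ℝ × ℝ => φ y.1) _ strip x :=
    (hφ.hasDerivAt.hasFDerivAt.comp x hasFDerivAt_fst).hasFDerivWithinAt
  have h : HasFDerivWithinAt (fun y => f y - φ y.1) _ strip x := hf.hasFDerivWithinAt.sub hφ'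
  simp [grad, h.fderivWithin (uniqueDiffOn_strip x hx)]

lemma IsRegular.sub_comp_fst (hf : IsRegular f) (hφ : ContDiff ℝ 1 φ) :
    IsRegular fun x => f x - φ x.1 := by
  have hgrad {x : ℝ × ℝ} (hx : x ∈ strip) := grad_sub_comp_fst hx (hf.differentiableOn x hx)
    (hφ.differentiable one_ne_zero x.1)
  refine ⟨hf.contDiffOn.sub (hφ.comp contDiff_fst).contDiffOn, fun q => ?_, fun q => ?_⟩
  · rw [hgrad (by simp [mem_strip])]
    simpa using hf.grad_top q
  · rw [hgrad (by simp [mem_strip])]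
    simpa using hf.grad_bot q

lemma eventually_eq_of_eventually_deriv_eq_zero (hφ : Differentiable ℝ φ) {q : ℝ}
    (h : ∀ᶠ t in 𝓝 q, deriv φ t = 0) : ∀ᶠ t in 𝓝 q, φ t = φ q := by
  obtain ⟨r, hr, hball⟩ := Metric.eventually_nhds_iff_ball.1 h
  filter_upwards [Metric.ball_mem_nhds q hr] with t ht
  exact Metric.isOpen_ball.is_const_of_deriv_eq_zero (convex_ball q r).isPreconnected
    hφ.differentiableOn hball ht (Metric.mem_ball_self hr)

/-- A critical point of `f - φ` can only lie where the slope of `f` is less than `δ`, and there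
`φ` is locally constant. -/
lemma IsRegular.isCritical_not_isLocalMaxOn_of_sub_comp_fst (hf : IsRegular f)
    (hφ : ContDiff ℝ 1 φ) {δ : ℝ} (hδ : 0 < δ)
    (hflat : ∀ t, |deriv φ t| ≤ max 0 (lineSlope f t - δ)) {x : ℝ × ℝ}
    (hx : IsCritical (fun y => f y - φ y.1) x)
    (hmax : ¬ IsLocalMaxOn (fun y => f y - φ y.1) strip x) :
    IsCritical f x ∧ ¬ IsLocalMaxOn f strip x := by
  have hgrad : grad f x = (deriv φ x.1, 0) := by
    rw [← sub_eq_zero, ← grad_sub_comp_fst hx.1 (hf.differentiableOn x hx.1)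
      (hφ.differentiable one_ne_zero x.1)]
    exact ((hf.sub_comp_fst hφ).isCritical_iff hx.1).1 hx
  have hslope : lineSlope f x.1 < δ := by
    have hle : lineSlope f x.1 ≤ max 0 (lineSlope f x.1 - δ) := calc
      lineSlope f x.1 ≤ ‖grad f x‖ := lineSlope_le hf.continuousOn_grad hx.1
      _ = |deriv φ x.1| := by simp [hgrad, Prod.norm_def]
      _ ≤ _ := hflat x.1
    rcases le_max_iff.1 hle with h | h <;> linarith
  have hderiv : ∀ᶠ t in 𝓝 x.1, deriv φ t = 0 := by
    filter_upwards [(continuous_lineSlope hf.continuousOn_grad).continuousAt.eventually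
      (gt_mem_nhds hslope)] with t ht
    simpa [max_eq_left (sub_nonpos.2 ht.le)] using hflat t
  refine ⟨(hf.isCritical_iff hx.1).2 (by rw [hgrad, hderiv.self_of_nhds]; rfl), fun h => hmax ?_⟩
  have hconst : ∀ᶠ y in 𝓝[strip] x, φ y.1 = φ x.1 :=
    (continuous_fst.continuousAt.eventually (eventually_eq_of_eventually_deriv_eq_zero
      (hφ.differentiable one_ne_zero) hderiv)).filter_mono nhdsWithin_le_nhds
  filter_upwards [h, hconst] with y hy hφy
  simpa [hφy] using hy

end SubCompFst

lemma integral_le_integral_of_eqOn {g w : ℝ → ℝ} {a b c d : ℝ} (hca : c ≤ a) (hab : a ≤ b)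
    (hbd : b ≤ d) (heq : EqOn w g (Icc a b)) (hg₀ : ∀ t ∈ Ioc c d, 0 ≤ g t)
    (hg : IntervalIntegrable g volume c d) : ∫ t in a..b, w t ≤ ∫ t in c..d, g t := by
  rw [intervalIntegral.integral_congr (uIcc_of_le hab ▸ heq)]
  exact intervalIntegral.integral_mono_interval hca hab hbd
    (ae_restrict_of_forall_mem measurableSet_Ioc hg₀) hg

/-- Integrate `χ * w`, where the continuous cutoff `χ` is `-1` on `(-∞, u₁ - 1]`, `0` on
`[u₁, u₂]` and `1` on `[u₂ + 1, ∞)`. -/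
lemma exists_contDiff_abs_deriv_le_and_integral_le {w : ℝ → ℝ} (hw : Continuous w)
    (hw₀ : ∀ t, 0 ≤ w t) {u₁ u₂ : ℝ} (hu : u₁ ≤ u₂) :
    ∃ φ : ℝ → ℝ, ContDiff ℝ 1 φ ∧ (∀ t, |deriv φ t| ≤ w t) ∧ (∀ t ∈ Icc u₁ u₂, φ t = 0) ∧
      (∀ t ≤ u₁ - 1, ∫ s in t..u₁ - 1, w s ≤ φ t) ∧ ∀ t ≥ u₂ + 1, ∫ s in u₂ + 1..t, w s ≤ φ t := by
  set χ : ℝ → ℝ := fun t => min 1 (max 0 (t - u₂)) - min 1 (max 0 (u₁ - t))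
  have hχ₁ (t : ℝ) : |χ t| ≤ 1 := by grind
  have hg : Continuous fun t => χ t * w t := by fun_prop
  have hgi (a b : ℝ) : IntervalIntegrable (fun t => χ t * w t) volume a b :=
    hg.intervalIntegrable a b
  have hderiv (t : ℝ) := (hg.integral_hasStrictDerivAt u₁ t).hasDerivAt
  refine ⟨fun t => ∫ s in u₁..t, χ s * w s, contDiff_one_iff_deriv.2
    ⟨fun t => (hderiv t).differentiableAt, ?_⟩, fun t => ?_, fun t ht => ?_, fun t ht => ?_,
    fun t ht => ?_⟩
  · rwa [funext fun t => (hderiv t).deriv]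
  · rw [(hderiv t).deriv, abs_mul, abs_of_nonneg (hw₀ t)]
    exact mul_le_of_le_one_left (hw₀ t) (hχ₁ t)
  · refine intervalIntegral.integral_zero_ae (ae_of_all _ fun s hs => ?_)
    rw [uIoc_of_le ht.1] at hs
    have : χ s = 0 := by grind
    rw [this, zero_mul]
  · beta_reduce
    rw [intervalIntegral.integral_symm t u₁, ← intervalIntegral.integral_neg]
    refine integral_le_integral_of_eqOn le_rfl ht (by linarith) (fun s hs => ?_) (fun s hs => ?_)
      (hgi _ _).neg
    · rw [show χ s = -1 by grind, neg_one_mul, neg_neg]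
    · exact neg_nonneg.2 (mul_nonpos_of_nonpos_of_nonneg (by grind) (hw₀ s))
  · refine integral_le_integral_of_eqOn (by linarith) ht le_rfl (fun s hs => ?_) (fun s hs => ?_)
      (hgi _ _)
    · rw [show χ s = 1 by grind, one_mul]
    · exact mul_nonneg (by grind) (hw₀ s)

/-- The mountain pass for `f - φ`, whose critical points are critical for `f` and which is low over
`a` and `b`. -/
theorem IsValley.exists_isCritical_not_isLocalMaxOn_of_integral {f : ℝ × ℝ → ℝ}
    {γ A q₁ q₀ q₂ : ℝ} (hV : IsValley f γ A q₁ q₀ q₂) (hf : IsRegular f) {δ : ℝ} (hδ : 0 < δ)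
    {a b : ℝ} (haq : a ≤ q₁ - 1) (hqb : q₂ + 1 ≤ b) (ha : lineMax f a ≤ γ) (hb : lineMax f b ≤ γ)
    (haA : γ - A < ∫ t in a..q₁ - 1, max 0 (lineSlope f t - δ))
    (hbA : γ - A < ∫ t in q₂ + 1..b, max 0 (lineSlope f t - δ)) :
    ∃ x, x.1 ∈ Ioo a b ∧ IsCritical f x ∧ ¬ IsLocalMaxOn f strip x := by
  have hw : Continuous fun t => max 0 (lineSlope f t - δ) :=
    continuous_const.max ((continuous_lineSlope hf.continuousOn_grad).sub continuous_const)
  obtain ⟨φ, hφ, hφw, hφ₀, hφa, hφb⟩ := exists_contDiff_abs_deriv_le_and_integral_le hw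
    (fun t => le_max_left _ _) (hV.le_left.trans hV.le_right)
  have hmax (q : ℝ) := lineMax_sub_comp_fst hf.continuousOn hφ.continuous q
  have hV' : IsValley (fun x => f x - φ x.1) γ A q₁ q₀ q₂ := by
    refine ⟨hV.le_left, hV.le_right, ?_, ?_, ?_, fun x hx => ?_⟩
    · simpa [hmax, hφ₀ _ ⟨le_rfl, hV.le_left.trans hV.le_right⟩] using hV.high_left
    · simpa [hmax, hφ₀ _ ⟨hV.le_left, hV.le_right⟩] using hV.low
    · simpa [hmax, hφ₀ _ ⟨hV.le_left.trans hV.le_right, le_rfl⟩] using hV.high_right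
    · simpa [hφ₀ _ hx.1] using hV.bound x hx
  obtain ⟨x, hx, hcrit, hloc⟩ := hV'.exists_isCritical_not_isLocalMaxOn (hf.sub_comp_fst hφ)
    (show a < q₁ by linarith) (show q₂ < b by linarith) (by linarith [hmax a, hφa a haq])
    (by linarith [hmax b, hφb b hqb])
  exact ⟨x, hx, hf.isCritical_not_isLocalMaxOn_of_sub_comp_fst hφ hδ hφw hcrit hloc⟩

/-! ### Barriers -/

/-- Over `[q, q + δ]` the gradient of `f` has norm at least `2 * δ`, so that subtracting a function
`φ` with `|φ'| ≤ max 0 (lineSlope f - δ)` can lower `f` by at least `δ ^ 2` across this interval. -/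
def IsBarrier (f : ℝ × ℝ → ℝ) (δ q : ℝ) : Prop :=
  ∀ x ∈ Icc q (q + δ) ×ˢ Icc (-1 : ℝ) 1, 2 * δ ≤ ‖grad f x‖

section Barrier

variable {f : ℝ × ℝ → ℝ}

lemma exists_isBarrier_of_lineSlope_pos (hf : ContinuousOn (grad f) strip) {q : ℝ}
    (hq : 0 < lineSlope f q) : ∃ n : ℕ, IsBarrier f (1 / (n + 1)) q := by
  obtain ⟨ε, hε, hball⟩ := Metric.eventually_nhds_iff_ball.1
    ((continuous_lineSlope hf).continuousAt.eventually (lt_mem_nhds (half_lt_self hq)))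
  obtain ⟨n, hn⟩ := exists_nat_one_div_lt (lt_min hε (by positivity : 0 < lineSlope f q / 4))
  refine ⟨n, fun x hx => ?_⟩
  have hxε : x.1 ∈ Metric.ball q ε := by
    rw [Real.ball_eq_Ioo]
    exact ⟨by linarith [hx.1.1], by linarith [hx.1.2, hn.trans_le (min_le_left _ _)]⟩
  linarith [hball _ hxε, lineSlope_le hf (mem_strip.2 hx.2), hn.trans_le (min_le_right _ _)]

lemma IsBarrier.sq_le_integral {δ q : ℝ} (hq : IsBarrier f δ q) (hδ : 0 ≤ δ)
    (hf : ContinuousOn (grad f) strip) :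
    δ ^ 2 ≤ ∫ t in q..q + δ, max 0 (lineSlope f t - δ) := by
  have hw : Continuous fun t => max 0 (lineSlope f t - δ) :=
    continuous_const.max ((continuous_lineSlope hf).sub continuous_const)
  calc δ ^ 2 = ∫ _ in q..q + δ, δ := by simp [sq]
    _ ≤ _ := by
      refine intervalIntegral.integral_mono_on (by linarith) (by simp) (hw.intervalIntegrable _ _)
        fun t ht => le_max_of_le_right ?_
      linarith [(le_lineSlope_iff hf).2 fun p hp => hq (t, p) ⟨ht, hp⟩]

lemma tendsto_atTop_of_monotone_of_add_le {F : ℝ → ℝ} (hF : Monotone F) {ε : ℝ} (hε : 0 < ε)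
    (h : ∀ R, ∃ s ≥ R, ∃ t, F s + ε ≤ F t) : Tendsto F atTop atTop := by
  rcases tendsto_atTop_of_monotone hF with hlim | ⟨l, hl⟩
  · exact hlim
  · obtain ⟨R, hR⟩ := eventually_atTop.1 (hl.eventually (lt_mem_nhds (sub_lt_self l hε)))
    obtain ⟨s, hs, t, hst⟩ := h R
    linarith [hR s hs, hF.ge_of_tendsto hl t]

lemma tendsto_integral_lineSlope_sub (hf : ContinuousOn (grad f) strip) {δ : ℝ} (hδ : 0 < δ)
    (h : ∀ R, ∃ q ≥ R, IsBarrier f δ q) (a : ℝ) :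
    Tendsto (fun b => ∫ t in a..b, max 0 (lineSlope f t - δ)) atTop atTop := by
  have hw : Continuous fun t => max 0 (lineSlope f t - δ) :=
    continuous_const.max ((continuous_lineSlope hf).sub continuous_const)
  have hadd (b c : ℝ) : (∫ t in a..b, max 0 (lineSlope f t - δ)) +
      ∫ t in b..c, max 0 (lineSlope f t - δ) = ∫ t in a..c, max 0 (lineSlope f t - δ) :=
    intervalIntegral.integral_add_adjacent_intervals (hw.intervalIntegrable _ _)
      (hw.intervalIntegrable _ _)
  refine tendsto_atTop_of_monotone_of_add_le (fun b c hbc => ?_) (pow_pos hδ 2) fun R => ?_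
  · rw [← hadd b c]
    exact le_add_of_nonneg_right
      (intervalIntegral.integral_nonneg hbc fun t _ => le_max_left _ _)
  · obtain ⟨q, hq, hbar⟩ := h R
    refine ⟨q, hq, q + δ, ?_⟩
    rw [← hadd q (q + δ)]
    gcongr
    exact hbar.sq_le_integral hδ.le hf

end Barrier

/-! ### Infinitely many critical points -/

lemma infinite_of_forall_exists_fst_gt {S : Set (ℝ × ℝ)} (h : ∀ R, ∃ x ∈ S, R < x.1) :
    S.Infinite :=
  Infinite.of_image Prod.fst <| infinite_of_forall_exists_gt fun R =>
    let ⟨x, hx, hR⟩ := h R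
    ⟨x.1, mem_image_of_mem _ hx, hR⟩

section Recurring

variable {f : ℝ × ℝ → ℝ} {γ A : ℝ}

lemma IsRegular.exists_isCriticalMax_of_lineMax (hf : IsRegular f) {a q b : ℝ} (haq : a ≤ q)
    (hqb : q ≤ b) (ha : lineMax f a ≤ γ) (hq : γ < lineMax f q) (hb : lineMax f b ≤ γ) :
    ∃ x, IsCriticalMax f x ∧ x.1 ∈ Ioo a b := by
  have hBs : Icc a b ×ˢ Icc (-1 : ℝ) 1 ⊆ strip := prod_mono (subset_univ _) subset_rfl
  obtain ⟨y, hys, rfl, hy⟩ := exists_eq_lineMax hf.continuousOn q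
  have hyB : y ∈ Icc a b ×ˢ Icc (-1 : ℝ) 1 := ⟨⟨haq, hqb⟩, mem_strip.1 hys⟩
  obtain ⟨x, hx, hmax⟩ := (isCompact_Icc.prod isCompact_Icc).exists_isMaxOn ⟨y, hyB⟩
    (hf.continuousOn.mono hBs)
  have hγ : γ < lineMax f x.1 :=
    (hq.trans_le (hy ▸ hmax hyB)).trans_le (le_lineMax hf.continuousOn (hBs hx))
  have hxab : x.1 ∈ Ioo a b :=
    ⟨hx.1.1.lt_of_ne fun h => (h ▸ ha).not_gt hγ, hx.1.2.lt_of_ne fun h => (h ▸ hb).not_gt hγ⟩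
  have hloc : IsLocalMaxOn f strip x := by
    filter_upwards [nhdsWithin_le_nhds (continuous_fst.continuousAt.eventually
      (isOpen_Ioo.mem_nhds hxab)), self_mem_nhdsWithin] with z hz hzs
    exact hmax ⟨Ioo_subset_Icc_self hz, mem_strip.1 hzs⟩
  exact ⟨x, ⟨hf.isCritical_of_isLocalMaxOn (hBs hx) hloc, hloc⟩, hxab⟩

theorem IsRegular.infinite_isCriticalMax (hf : IsRegular f)
    (hV : ∀ R, ∃ q₁ ≥ R, ∃ q₀ q₂, IsValley f γ A q₁ q₀ q₂) : {x | IsCriticalMax f x}.Infinite := by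
  refine infinite_of_forall_exists_fst_gt fun R => ?_
  obtain ⟨q₁, hq₁, a, q, hVa⟩ := hV R
  obtain ⟨q₁', hq₁', b, _, hVb⟩ := hV q
  obtain ⟨x, hx, hxab⟩ := hf.exists_isCriticalMax_of_lineMax hVa.le_right
    (hq₁'.le.trans hVb.le_left) hVa.low hVa.high_right hVb.low
  exact ⟨x, hx, (hq₁.le.trans hVa.le_left).trans_lt hxab.1⟩

theorem IsRegular.infinite_isSaddle_or_isCriticalMin (hf : IsRegular f) {δ : ℝ} (hδ : 0 < δ)
    (hV : ∀ R, ∃ q₁ ≥ R, ∃ q₀ q₂, IsValley f γ A q₁ q₀ q₂)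
    (hbar : ∀ R, ∃ q ≥ R, IsBarrier f δ q) :
    {x | (IsSaddle f x ∨ IsCriticalMin f x) ∧ ¬ IsCriticalMax f x}.Infinite := by
  refine infinite_of_forall_exists_fst_gt fun R => ?_
  have hfar (a : ℝ) : ∃ R' ≥ a, ∀ b ≥ R', γ - A < ∫ t in a..b, max 0 (lineSlope f t - δ) :=
    let ⟨R', h⟩ := eventually_atTop.1 ((tendsto_integral_lineSlope_sub hf.continuousOn_grad hδ
      hbar a).eventually_gt_atTop (γ - A))
    ⟨max a R', le_max_left _ _, fun b hb => h b ((le_max_right _ _).trans hb)⟩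
  obtain ⟨r, hr, a, _, hVa⟩ := hV R
  obtain ⟨Ra, haR, hRa⟩ := hfar a
  obtain ⟨q₁, hq₁, q₀, q₂, hVq⟩ := hV (Ra + 1)
  obtain ⟨Rb, hbR, hRb⟩ := hfar (q₂ + 1)
  obtain ⟨s, hs, b, _, hVb⟩ := hV Rb
  have hsb := hVb.le_left
  obtain ⟨x, hx, hcrit, hmax⟩ := hVq.exists_isCritical_not_isLocalMaxOn_of_integral hf hδ
    (show a ≤ q₁ - 1 by linarith) (show q₂ + 1 ≤ b by linarith) hVa.low hVb.low
    (hRa _ (by linarith)) (hRb _ (by linarith))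
  refine ⟨x, ⟨?_, fun h => hmax h.2⟩, (hr.le.trans hVa.le_left).trans_lt hx.1⟩
  by_cases hmin : IsLocalMinOn f strip x
  · exact .inr ⟨hcrit, hmin⟩
  · exact .inl ⟨hcrit, hmax, hmin⟩

end Recurring

/-! ### Existence of valleys -/

lemma exists_rat_gt_mem {U : Set ℝ} (hU : IsOpen U) (hrec : ∀ R, ∃ q ≥ R, q ∈ U) (R : ℝ) :
    ∃ r : ℚ, R < r ∧ (r : ℝ) ∈ U := by
  obtain ⟨q, hq, hqU⟩ := hrec (R + 1)
  exact Rat.denseRange_cast.exists_mem_open (isOpen_Ioi.inter hU)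
    ⟨q, (lt_add_one R).trans_le hq, hqU⟩

lemma exists_rat_isValley {f : ℝ × ℝ → ℝ} (hf : ContinuousOn f strip) {γ : ℝ}
    (hlow : ∀ R, ∃ q ≥ R, lineMax f q < γ) (hhigh : ∀ R, ∃ q ≥ R, γ < lineMax f q) :
    ∃ (r₁ r₀ r₂ : ℚ) (N : ℕ), IsValley f γ (-N) r₁ r₀ r₂ := by
  have hmax := continuous_lineMax hf
  obtain ⟨r₁, -, h₁⟩ := exists_rat_gt_mem (isOpen_lt continuous_const hmax) hhigh 0
  obtain ⟨r₀, hr₀, h₀⟩ := exists_rat_gt_mem (isOpen_lt hmax continuous_const) hlow r₁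
  obtain ⟨r₂, hr₂, h₂⟩ := exists_rat_gt_mem (isOpen_lt continuous_const hmax) hhigh r₀
  obtain ⟨A, hA⟩ := (isCompact_Icc.prod isCompact_Icc).bddBelow_image
    (hf.mono (prod_mono (subset_univ (Icc (r₁ : ℝ) r₂)) subset_rfl))
  obtain ⟨N, hN⟩ := exists_nat_ge (-A)
  exact ⟨r₁, r₀, r₂, N, hr₀.le, hr₂.le, h₁, h₀.le, h₂, fun x hx =>
    (neg_le.1 hN).trans (hA (mem_image_of_mem f hx))⟩

/-! ### Translations -/

section Translate

variable (f : ℝ × ℝ → ℝ) (a : ℝ)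

lemma lineMax_translate (q : ℝ) : lineMax (fun x => f (x + (a, 0))) q = lineMax f (q + a) := by
  simp [lineMax]

open scoped Pointwise in
lemma grad_translate (x : ℝ × ℝ) : grad (fun y => f (y + (a, 0))) x = grad f (x + (a, 0)) := by
  have hstrip : ((a, 0) : ℝ × ℝ) +ᵥ strip = strip := by
    ext x
    rw [mem_vadd_set_iff_neg_vadd_mem]
    simp [mem_strip]
  simp only [grad, fderivWithin_comp_add_right, hstrip]

lemma lineSlope_translate (q : ℝ) :
    lineSlope (fun x => f (x + (a, 0))) q = lineSlope f (q + a) := by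
  simp [lineSlope, grad_translate]

variable {f a}

lemma forall_mem_Icc_prod_of_translate {s t : ℝ} {I : Set ℝ} {p : ℝ × ℝ → Prop}
    (h : ∀ x ∈ Icc s t ×ˢ I, p (x + (a, 0))) : ∀ x ∈ Icc (s + a) (t + a) ×ˢ I, p x := by
  intro x hx
  have hxa : x - (a, 0) ∈ Icc s t ×ˢ I :=
    ⟨⟨le_sub_iff_add_le.2 hx.1.1, sub_le_iff_le_add.2 hx.1.2⟩, by simpa using hx.2⟩
  simpa using h _ hxa

lemma IsBarrier.of_translate {δ q : ℝ} (h : IsBarrier (fun x => f (x + (a, 0))) δ q) :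
    IsBarrier f δ (q + a) := by
  simp only [IsBarrier, grad_translate] at h
  simpa only [IsBarrier, add_right_comm] using
    forall_mem_Icc_prod_of_translate (p := fun x => 2 * δ ≤ ‖grad f x‖) h

lemma IsValley.of_translate {γ A q₁ q₀ q₂ : ℝ}
    (h : IsValley (fun x => f (x + (a, 0))) γ A q₁ q₀ q₂) :
    IsValley f γ A (q₁ + a) (q₀ + a) (q₂ + a) where
  le_left := by simpa using h.le_left
  le_right := by simpa using h.le_right
  high_left := by simpa [lineMax_translate] using h.high_left
  low := by simpa [lineMax_translate] using h.low
  high_right := by simpa [lineMax_translate] using h.high_right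
  bound := forall_mem_Icc_prod_of_translate (p := fun x => A ≤ f x) h.bound

end Translate

/-! ### Ergodic flows -/

/-- The continuous flow `τ` preserves `P`, and invariant measurable sets are trivial. -/
structure IsErgodicFlow {Ω : Type*} [TopologicalSpace Ω] [MeasurableSpace Ω] (τ : Flow ℝ Ω)
    (P : Measure Ω) : Prop where
  measurePreserving : ∀ a, MeasurePreserving (τ a) P P
  ergodic : ∀ A, MeasurableSet A → (∀ a, τ a ⁻¹' A = A) → P A = 0 ∨ P Aᶜ = 0

section OccupationTime

variable {Ω : Type*} [TopologicalSpace Ω] {τ : Flow ℝ Ω} {B : Set Ω}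

/-- The amount of time after `R` that the orbit of `ω` spends in `B`. -/
noncomputable def occupationTime (τ : Flow ℝ Ω) (B : Set Ω) (R : ℝ) (ω : Ω) : ENNReal :=
  volume {q | R ≤ q ∧ τ q ω ∈ B}

lemma occupationTime_flow (R a : ℝ) (ω : Ω) :
    occupationTime τ B R (τ a ω) = occupationTime τ B (R + a) ω := by
  rw [occupationTime, occupationTime,
    ← measure_preimage_add_right volume a {q | R + a ≤ q ∧ τ q ω ∈ B}]
  simp [τ.map_add]

lemma occupationTime_ne_zero_of_le {R S : ℝ} (hRS : R ≤ S) {ω : Ω}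
    (hS : occupationTime τ B S ω ≠ 0) : occupationTime τ B R ω ≠ 0 :=
  fun hR => hS (measure_mono_null
    (inter_subset_inter_left {q | τ q ω ∈ B} (Ici_subset_Ici.2 hRS)) hR)

lemma iterate_flow_one (n : ℕ) (ω : Ω) : (τ 1)^[n] ω = τ n ω := by
  induction n with
  | zero => simp
  | succ n ih => rw [Function.iterate_succ_apply', ih, ← τ.map_add, Nat.cast_succ, add_comm]

end OccupationTime

section Recurrence

variable {Ω : Type*} [TopologicalSpace Ω] [MeasurableSpace Ω] [BorelSpace Ω] {τ : Flow ℝ Ω}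
  {P : Measure Ω} {B : Set Ω}

lemma IsInvariantErgodic.isErgodicFlow (hP : IsInvariantErgodic τ P) : IsErgodicFlow τ P := by
  have hpre (a : ℝ) (A : Set Ω) : τ (-a) '' A = τ a ⁻¹' A := by
    rw [Flow.image_eq_preimage_symm, neg_neg]
  refine ⟨fun a => ⟨(τ.continuous_toFun a).measurable, Measure.ext fun A hA => ?_⟩,
    fun A hA hinv => ?_⟩
  · rw [Measure.map_apply (τ.continuous_toFun a).measurable hA, ← hpre, hP.invariant _ A hA]
  · have : IsProbabilityMeasure P := ⟨hP.prob⟩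
    refine (hP.ergodic A hA fun a => ?_).symm.imp_right (prob_compl_eq_zero_iff hA).2
    rw [← neg_neg a, hpre, hinv]

lemma measurable_flow (τ : Flow ℝ Ω) : Measurable fun x : Ω × ℝ => τ x.2 x.1 :=
  (τ.continuous continuous_snd continuous_fst).measurable

lemma measurable_occupationTime (hB : MeasurableSet B) (R : ℝ) :
    Measurable (occupationTime τ B R) :=
  measurable_measure_prodMk_left
    ((measurableSet_le measurable_const measurable_snd).inter (measurable_flow τ hB))

lemma measurableSet_occupationTime_ne_zero (hB : MeasurableSet B) (R : ℝ) :
    MeasurableSet {ω | occupationTime τ B R ω ≠ 0} :=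
  measurable_occupationTime hB R (measurableSet_singleton 0).compl

lemma measure_occupationTime_ne_zero [SFinite P] (hτ : ∀ a, MeasurePreserving (τ a) P P)
    (hB : MeasurableSet B) (hpos : P B ≠ 0) : P {ω | occupationTime τ B 0 ω ≠ 0} ≠ 0 := by
  intro h
  have htime : ∀ᵐ ω ∂P, ∀ᵐ q ∂volume.restrict (Ici (0 : ℝ)), τ q ω ∉ B := by
    filter_upwards [ae_iff.2 h] with ω hω
    rw [ae_restrict_iff' measurableSet_Ici, ae_iff]
    simpa [occupationTime] using hω
  rw [Measure.ae_ae_comm (p := fun ω q => τ q ω ∉ B) (measurable_flow τ hB.compl)] at htime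
  have : NeBot (ae (volume.restrict (Ici (0 : ℝ)))) := ae_neBot.2 (by simp)
  obtain ⟨q, hq⟩ := htime.exists
  rw [← (hτ q).measure_preimage hB.nullMeasurableSet] at hpos
  exact hpos (measure_eq_zero_iff_ae_notMem.2 hq)

/-- The orbits that spend a positive time in `B` after every `R` form an invariant set, which has
positive measure by Fubini's theorem and Poincaré recurrence. -/
lemma IsErgodicFlow.ae_occupationTime_ne_zero [IsFiniteMeasure P] (hP : IsErgodicFlow τ P)
    (hB : MeasurableSet B) (hpos : P B ≠ 0) : ∀ᵐ ω ∂P, ∀ R, occupationTime τ B R ω ≠ 0 := by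
  set A : Set Ω := {ω | ∀ R, occupationTime τ B R ω ≠ 0} with hA
  have hnat (ω : Ω) : ω ∈ A ↔ ∀ n : ℕ, occupationTime τ B n ω ≠ 0 := by
    refine ⟨fun h n => h n, fun h R => ?_⟩
    obtain ⟨n, hn⟩ := exists_nat_ge R
    exact occupationTime_ne_zero_of_le hn (h n)
  have hAm : MeasurableSet A := by
    have : A = ⋂ n : ℕ, {ω | occupationTime τ B n ω ≠ 0} := by
      ext ω
      simp only [hnat, mem_iInter, mem_ofPred_eq]
    rw [this]
    exact MeasurableSet.iInter fun n => measurableSet_occupationTime_ne_zero hB n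
  have hinv (a : ℝ) : τ a ⁻¹' A = A := by
    ext ω
    simp only [hA, mem_preimage, mem_ofPred_eq, occupationTime_flow]
    exact ((add_right_surjective a).forall (p := fun R => occupationTime τ B R ω ≠ 0)).symm
  have hrec : ∀ᵐ ω ∂P, occupationTime τ B 0 ω ≠ 0 → ω ∈ A := by
    filter_upwards [(hP.measurePreserving 1).conservative.ae_mem_imp_frequently_image_mem
      (measurableSet_occupationTime_ne_zero hB 0).nullMeasurableSet] with ω hω hpos
    refine (hnat ω).2 fun n => ?_
    obtain ⟨m, hnm, hm⟩ := frequently_atTop.1 (hω hpos) n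
    rw [iterate_flow_one, occupationTime_flow, zero_add] at hm
    exact occupationTime_ne_zero_of_le (Nat.cast_le.2 hnm) hm
  have hA₀ : P A ≠ 0 := fun h => measure_occupationTime_ne_zero hP.measurePreserving hB hpos <|
    measure_eq_zero_iff_ae_notMem.2 <| by
      filter_upwards [hrec, measure_eq_zero_iff_ae_notMem.1 h] with ω h₁ h₂ h₃ using h₂ (h₁ h₃)
  exact (hP.ergodic A hAm hinv).resolve_left hA₀

theorem IsErgodicFlow.ae_recurrent [IsFiniteMeasure P] (hP : IsErgodicFlow τ P)
    (hB : NullMeasurableSet B P) (hpos : ∃ᵐ ω ∂P, ω ∈ B) : ∀ᵐ ω ∂P, ∀ R, ∃ q ≥ R, τ q ω ∈ B := by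
  obtain ⟨B', hsub, hB', hae⟩ := hB.exists_measurable_subset_ae_eq
  have hpos' : P B' ≠ 0 := (measure_congr hae).trans_ne (frequently_ae_iff.1 hpos)
  filter_upwards [hP.ae_occupationTime_ne_zero hB' hpos'] with ω hω R
  obtain ⟨q, hq, hqB⟩ := nonempty_of_measure_ne_zero (hω R)
  exact ⟨q, hq, hsub hqB⟩

end Recurrence

/-! ### Random fields -/

section ConstantOrCrossing

variable {Ω : Type*} {l : Filter Ω} [CountableInterFilter l]

lemma exists_frequently_of_frequently_exists {ι : Type*} [Countable ι] {p : ι → Ω → Prop}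
    (h : ∃ᶠ ω in l, ∃ i, p i ω) : ∃ i, ∃ᶠ ω in l, p i ω := by
  contrapose! h
  simpa only [not_frequently, not_exists, eventually_countable_forall] using h

lemma exists_frequently_lt_frequently_gt {Y : Ω → ℝ} (h : ¬ ∃ c, ∀ᶠ ω in l, Y ω = c) :
    ∃ γ, (∃ᶠ ω in l, Y ω < γ) ∧ ∃ᶠ ω in l, γ < Y ω := by
  obtain ⟨α, hle, hgt⟩ : ∃ α, (∃ᶠ ω in l, Y ω ≤ α) ∧ ∃ᶠ ω in l, α < Y ω := by
    contrapose! h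
    refine exists_eventuallyEq_const_of_forall_separating (· ∈ range (Iic (α := ℝ))) ?_
    rintro _ ⟨α, rfl⟩
    refine (em (∃ᶠ ω in l, Y ω ≤ α)).imp (fun hα => ?_) fun hα => ?_
    · simpa using h α hα
    · simpa using hα
  obtain ⟨γ, hγ⟩ :=
    exists_frequently_of_frequently_exists <| hgt.mono fun ω hω => exists_rat_btwn hω
  exact ⟨γ, hle.mono fun ω hω => hω.trans_lt hγ.exists.choose_spec.1, hγ.mono fun ω hω => hω.2⟩

end ConstantOrCrossing

lemma nullMeasurableSet_forall_mem {Ω X Y : Type*} [MeasurableSpace Ω] {P : Measure Ω}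
    [TopologicalSpace X] [SecondCountableTopology X] [TopologicalSpace Y] {g : Ω → X → Y}
    {S : Set X} {T : Set Y} (hg : ∀ᵐ ω ∂P, ContinuousOn (g ω) S) (hT : IsClosed T)
    (hm : ∀ x ∈ S, NullMeasurableSet {ω | g ω x ∈ T} P) :
    NullMeasurableSet {ω | ∀ x ∈ S, g ω x ∈ T} P := by
  obtain ⟨D, hDc, hD⟩ := TopologicalSpace.exists_countable_dense S
  have hDm : NullMeasurableSet (⋂ x ∈ D, {ω | g ω x ∈ T}) P :=
    NullMeasurableSet.biInter hDc fun x _ => hm x x.2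
  refine hDm.congr (eventuallyEq_set.2 ?_)
  filter_upwards [hg] with ω hω
  simp only [mem_iInter, mem_ofPred_eq]
  refine ⟨fun h x hx => ?_, fun h x _ => h x x.2⟩
  have hcl : IsClosed {x : S | g ω x ∈ T} := hT.preimage hω.domRestrict
  exact hcl.closure_subset_iff.2 (fun y hy => h y hy) (hD ⟨x, hx⟩)

section Realization

variable {Ω : Type*} [TopologicalSpace Ω] {τ : Flow ℝ Ω} {Kbar : Ω → ℝ → ℝ}

lemma realization_flow (τ : Flow ℝ Ω) (Kbar : Ω → ℝ → ℝ) (a : ℝ) (ω : Ω) :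
    realization τ Kbar (τ a ω) = fun x => realization τ Kbar ω (x + (a, 0)) := by
  ext ⟨q, p⟩
  simp [realization, τ.map_add]

lemma derivWithin_eq_grad_snd {f : ℝ × ℝ → ℝ} (hf : DifferentiableOn ℝ f strip) (q : ℝ) {p : ℝ}
    (hp : p ∈ Icc (-1 : ℝ) 1) :
    derivWithin (fun s => f (q, s)) (Icc (-1) 1) p = (grad f (q, p)).2 := by
  have hline : HasDerivWithinAt (fun s : ℝ => (q, s)) ((0 : ℝ), (1 : ℝ)) (Icc (-1) 1) p :=
    (hasDerivWithinAt_const p _ q).prodMk (hasDerivWithinAt_id p _)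
  exact ((hf (q, p) (mem_strip.2 hp)).hasFDerivWithinAt.comp_hasDerivWithinAt p hline
    fun s hs => mem_strip.2 hs).derivWithin (uniqueDiffOn_Icc (by norm_num) p hp)

variable [MeasurableSpace Ω] {P : Measure Ω}

lemma IsC1.ae_isRegular (hK : IsC1 τ P Kbar)
    (htop : ∀ᵐ ω ∂P, ∀ q : ℝ, derivWithin (Kbar (τ q ω)) (Icc (-1) 1) 1 < 0)
    (hbot : ∀ᵐ ω ∂P, ∀ q : ℝ, 0 < derivWithin (Kbar (τ q ω)) (Icc (-1) 1) (-1)) :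
    ∀ᵐ ω ∂P, IsRegular (realization τ Kbar ω) := by
  filter_upwards [hK.contDiffOn, htop, hbot] with ω hω htop hbot
  have hd := hω.differentiableOn one_ne_zero
  refine ⟨hω, fun q => ?_, fun q => ?_⟩
  · rw [← derivWithin_eq_grad_snd hd q (by simp)]
    exact htop q
  · rw [← derivWithin_eq_grad_snd hd q (by simp)]
    exact hbot q

lemma ae_forall_line_eq (hτ : ∀ a, MeasurePreserving (τ a) P P) {L : (ℝ × ℝ → ℝ) → ℝ → ℝ}
    (hL : ∀ f a q, L (fun x => f (x + (a, 0))) q = L f (q + a)) {c : ℝ}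
    (hcont : ∀ᵐ ω ∂P, Continuous (L (realization τ Kbar ω)))
    (hc : ∀ᵐ ω ∂P, L (realization τ Kbar ω) 0 = c) :
    ∀ᵐ ω ∂P, ∀ q, L (realization τ Kbar ω) q = c := by
  have hrat : ∀ᵐ ω ∂P, ∀ r : ℚ, L (realization τ Kbar (τ r ω)) 0 = c :=
    ae_all_iff.2 fun r => (hτ r).quasiMeasurePreserving.ae hc
  simp only [realization_flow, hL, zero_add] at hrat
  filter_upwards [hcont, hrat] with ω hω hr
  exact congrFun (Rat.denseRange_cast.equalizer hω continuous_const (funext hr))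

variable [BorelSpace Ω]

lemma IsC1.measurable_realization (hK : IsC1 τ P Kbar) {x : ℝ × ℝ} (hx : x ∈ strip) :
    Measurable fun ω => realization τ Kbar ω x :=
  hK.measurable.comp (g := fun y : Ω × Icc (-1 : ℝ) 1 => Kbar y.1 y.2) (f := fun ω =>
    (τ x.1 ω, ⟨x.2, mem_strip.1 hx⟩)) <|
    (τ.continuous_toFun x.1).measurable.prodMk measurable_const

lemma IsC1.aemeasurable_fderivWithin (hK : IsC1 τ P Kbar) {x v : ℝ × ℝ} (hx : x ∈ strip)
    (hxv : x + v ∈ strip) :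
    AEMeasurable (fun ω => fderivWithin ℝ (realization τ Kbar ω) strip x v) P := by
  let d : ℕ → ℝ × ℝ := fun n => (n + 1 : ℝ)⁻¹ • v
  have hd (n : ℕ) : x + d n ∈ strip := convex_strip.add_smul_mem hx hxv
    ⟨by positivity, inv_le_one_of_one_le₀ (by linarith [n.cast_nonneg (α := ℝ)])⟩
  have hd₀ : Tendsto d atTop (𝓝 0) := by
    simpa [d] using (tendsto_one_div_add_atTop_nhds_zero_nat (𝕜 := ℝ)).smul_const v
  have hdv (n : ℕ) : (n + 1 : ℝ) • d n = v := smul_inv_smul₀ (by positivity) v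
  refine aemeasurable_of_tendsto_metrizable_ae atTop (fun n =>
    (((hK.measurable_realization (hd n)).sub (hK.measurable_realization hx)).const_smul
      (n + 1 : ℝ)).aemeasurable) ?_
  filter_upwards [hK.contDiffOn] with ω hω
  exact (hω.differentiableOn one_ne_zero x hx).hasFDerivWithinAt.lim hd₀ (.of_forall hd)
    (by simp only [hdv, tendsto_const_nhds])

lemma IsC1.aemeasurable_grad (hK : IsC1 τ P Kbar) {x : ℝ × ℝ} (hx : x ∈ strip) :
    AEMeasurable (fun ω => grad (realization τ Kbar ω) x) P := by
  obtain ⟨h₁, h₂⟩ := mem_strip.1 hx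
  refine (hK.aemeasurable_fderivWithin hx (by simpa [mem_strip] using ⟨h₁, h₂⟩)).prodMk ?_
  rcases le_total x.2 0 with h | h
  · exact hK.aemeasurable_fderivWithin hx (mem_strip.2
      ⟨show -1 ≤ x.2 + 1 by linarith, show x.2 + 1 ≤ 1 by linarith⟩)
  · have := hK.aemeasurable_fderivWithin (v := -(0, 1)) hx
      (mem_strip.2 ⟨show -1 ≤ x.2 + -1 by linarith, show x.2 + -1 ≤ 1 by linarith⟩)
    simpa only [map_neg, neg_neg, Pi.neg_def] using this.neg

lemma IsC1.aemeasurable_lineMax (hK : IsC1 τ P Kbar) (q : ℝ) :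
    AEMeasurable (fun ω => lineMax (realization τ Kbar ω) q) P := by
  refine NullMeasurable.aemeasurable <| measurable_of_Iic (δ := NullMeasurableSpace Ω P)
    fun α => ?_
  have hm : NullMeasurableSet
      {ω | ∀ p ∈ Icc (-1 : ℝ) 1, realization τ Kbar ω (q, p) ∈ Iic α} P :=
    nullMeasurableSet_forall_mem (hK.contDiffOn.mono fun ω hω =>
      continuousOn_vertical hω.continuousOn q) isClosed_Iic fun p hp =>
      (hK.measurable_realization (mem_strip.2 hp) measurableSet_Iic).nullMeasurableSet
  refine hm.congr (eventuallyEq_set.2 ?_)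
  filter_upwards [hK.contDiffOn] with ω hω using (lineMax_le_iff hω.continuousOn).symm

lemma IsC1.nullMeasurableSet_isBarrier (hK : IsC1 τ P Kbar) (δ q : ℝ) :
    NullMeasurableSet {ω | IsBarrier (realization τ Kbar ω) δ q} P :=
  nullMeasurableSet_forall_mem (T := Ici (2 * δ)) (hK.contDiffOn.mono fun _ hω =>
    ((continuousOn_grad hω).mono (prod_mono (subset_univ _) subset_rfl)).norm) isClosed_Ici
    fun _ hx => nullMeasurableSet_le aemeasurable_const
      (hK.aemeasurable_grad (mem_strip.2 hx.2)).norm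

lemma IsC1.nullMeasurableSet_isValley (hK : IsC1 τ P Kbar) (γ A q₁ q₀ q₂ : ℝ) :
    NullMeasurableSet {ω | IsValley (realization τ Kbar ω) γ A q₁ q₀ q₂} P := by
  have hbound : NullMeasurableSet
      {ω | ∀ x ∈ Icc q₁ q₂ ×ˢ Icc (-1 : ℝ) 1, realization τ Kbar ω x ∈ Ici A} P :=
    nullMeasurableSet_forall_mem (hK.contDiffOn.mono fun ω hω =>
      hω.continuousOn.mono (prod_mono (subset_univ _) subset_rfl)) isClosed_Ici fun x hx =>
      (hK.measurable_realization (mem_strip.2 hx.2) measurableSet_Ici).nullMeasurableSet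
  have hhigh (q : ℝ) : NullMeasurableSet {ω | γ < lineMax (realization τ Kbar ω) q} P :=
    nullMeasurableSet_lt aemeasurable_const (hK.aemeasurable_lineMax q)
  have hlow : NullMeasurableSet {ω | lineMax (realization τ Kbar ω) q₀ ≤ γ} P :=
    nullMeasurableSet_le (hK.aemeasurable_lineMax q₀) aemeasurable_const
  convert (((MeasurableSet.const (q₁ ≤ q₀ ∧ q₀ ≤ q₂)).nullMeasurableSet.inter
    (hhigh q₁)).inter (hlow.inter (hhigh q₂))).inter hbound using 1
  ext ω
  exact ⟨fun h => ⟨⟨⟨⟨h.le_left, h.le_right⟩, h.high_left⟩, h.low, h.high_right⟩, h.bound⟩,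
    fun h => ⟨h.1.1.1.1, h.1.1.1.2, h.1.1.2, h.1.2.1, h.1.2.2, h.2⟩⟩

end Realization

section Dichotomy

variable {Ω : Type*} [TopologicalSpace Ω] [MeasurableSpace Ω] [BorelSpace Ω] {τ : Flow ℝ Ω}
  {P : Measure Ω} [IsFiniteMeasure P] {Kbar : Ω → ℝ → ℝ}

lemma IsErgodicFlow.ae_recurrent_realization (hP : IsErgodicFlow τ P) (p : (ℝ × ℝ → ℝ) → Prop)
    (hp : NullMeasurableSet {ω | p (realization τ Kbar ω)} P)
    (hpos : ∃ᵐ ω ∂P, p (realization τ Kbar ω)) :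
    ∀ᵐ ω ∂P, ∀ R, ∃ q ≥ R, p fun x => realization τ Kbar ω (x + (q, 0)) := by
  simpa only [mem_ofPred_eq, realization_flow] using hP.ae_recurrent hp hpos

lemma IsErgodicFlow.exists_ae_recurrent_isValley (hP : IsErgodicFlow τ P) (hK : IsC1 τ P Kbar)
    (hconst : ¬ ∃ c, ∀ᵐ ω ∂P, lineMax (realization τ Kbar ω) 0 = c) :
    ∃ γ A, ∀ᵐ ω ∂P, ∀ R, ∃ q₁ ≥ R, ∃ q₀ q₂, IsValley (realization τ Kbar ω) γ A q₁ q₀ q₂ := by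
  obtain ⟨γ, hlow, hhigh⟩ := exists_frequently_lt_frequently_gt hconst
  have hmax := hK.aemeasurable_lineMax 0
  have hvalley : ∀ᵐ ω ∂P, ∃ r : ℚ × ℚ × ℚ × ℕ,
      IsValley (realization τ Kbar ω) γ (-r.2.2.2) r.1 r.2.1 r.2.2.1 := by
    filter_upwards [hK.contDiffOn,
      hP.ae_recurrent_realization (lineMax · 0 < γ)
        (nullMeasurableSet_lt hmax aemeasurable_const) hlow,
      hP.ae_recurrent_realization (γ < lineMax · 0)
        (nullMeasurableSet_lt aemeasurable_const hmax) hhigh]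
      with ω hω hlow hhigh
    simp only [lineMax_translate, zero_add] at hlow hhigh
    obtain ⟨r₁, r₀, r₂, N, hV⟩ := exists_rat_isValley hω.continuousOn hlow hhigh
    exact ⟨(r₁, r₀, r₂, N), hV⟩
  obtain ⟨⟨r₁, r₀, r₂, N⟩, hV⟩ := exists_frequently_of_frequently_exists
    ((hlow.and_eventually hvalley).mono fun _ h => h.2)
  refine ⟨γ, -N, ?_⟩
  filter_upwards [hP.ae_recurrent_realization (IsValley · γ (-N) r₁ r₀ r₂)
    (hK.nullMeasurableSet_isValley _ _ _ _ _) hV] with ω hω R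
  obtain ⟨a, ha, hVa⟩ := hω (R - r₁)
  exact ⟨r₁ + a, sub_le_iff_le_add'.1 ha, _, _, hVa.of_translate⟩

lemma IsErgodicFlow.exists_ae_recurrent_isBarrier (hP : IsErgodicFlow τ P) (hK : IsC1 τ P Kbar)
    (hslope : ¬ ∀ᵐ ω ∂P, lineSlope (realization τ Kbar ω) 0 = 0) :
    ∃ δ > 0, ∀ᵐ ω ∂P, ∀ R, ∃ q ≥ R, IsBarrier (realization τ Kbar ω) δ q := by
  have hbarrier : ∃ᵐ ω ∂P, ∃ n : ℕ, IsBarrier (realization τ Kbar ω) (1 / (n + 1)) 0 := by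
    refine ((not_eventually.1 hslope).and_eventually hK.contDiffOn).mono fun ω hω => ?_
    have hgrad := continuousOn_grad hω.2
    exact exists_isBarrier_of_lineSlope_pos hgrad ((lineSlope_nonneg hgrad 0).lt_of_ne' hω.1)
  obtain ⟨δ, hδ, hbar⟩ : ∃ δ > 0, ∃ᵐ ω ∂P, IsBarrier (realization τ Kbar ω) δ 0 :=
    let ⟨n, hn⟩ := exists_frequently_of_frequently_exists hbarrier
    ⟨1 / (n + 1), by positivity, hn⟩
  refine ⟨δ, hδ, ?_⟩
  filter_upwards [hP.ae_recurrent_realization (IsBarrier · δ 0)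
    (hK.nullMeasurableSet_isBarrier _ _) hbar] with ω hω R
  obtain ⟨a, ha, hb⟩ := hω R
  exact ⟨0 + a, by simpa using ha, hb.of_translate⟩

end Dichotomy

end RandomTwist

theorem mainTheorem6_general {Ω : Type*} [TopologicalSpace Ω] [MeasurableSpace Ω] [BorelSpace Ω]
    (τ : Flow ℝ Ω) (P : Measure Ω) [IsFiniteMeasure P] (hP : RandomTwist.IsErgodicFlow τ P)
    (Kbar : Ω → ℝ → ℝ) (hK : RandomTwist.IsC1 τ P Kbar)
    (htop : ∀ᵐ ω ∂P, ∀ q : ℝ, derivWithin (Kbar (τ q ω)) (Icc (-1) 1) 1 < 0)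
    (hbot : ∀ᵐ ω ∂P, ∀ q : ℝ, 0 < derivWithin (Kbar (τ q ω)) (Icc (-1) 1) (-1)) :
    (∀ᵐ ω ∂P, {x | RandomTwist.IsCritical (RandomTwist.realization τ Kbar ω) x}.Infinite) ∧
    ((∀ᵐ ω ∂P, RandomTwist.HasContinuumOfCriticalPoints (RandomTwist.realization τ Kbar ω)) ∨
      (∀ᵐ ω ∂P,
        {x | RandomTwist.IsCriticalMax (RandomTwist.realization τ Kbar ω) x}.Infinite ∧
        {x | (RandomTwist.IsSaddle (RandomTwist.realization τ Kbar ω) x ∨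
            RandomTwist.IsCriticalMin (RandomTwist.realization τ Kbar ω) x) ∧
          ¬ RandomTwist.IsCriticalMax (RandomTwist.realization τ Kbar ω) x}.Infinite)) := by
  have hreg := hK.ae_isRegular htop hbot
  refine (and_iff_right_of_imp fun hb => ?_).2 ?_
  · rcases hb with h | h
    · exact h.mono fun ω hω => hω.infinite
    · exact h.mono fun ω hω => hω.1.mono fun x hx => hx.1
  by_cases hconst : ∃ c, ∀ᵐ ω ∂P, RandomTwist.lineMax (RandomTwist.realization τ Kbar ω) 0 = c
  · obtain ⟨c, hc⟩ := hconst
    left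
    filter_upwards [hreg, RandomTwist.ae_forall_line_eq hP.measurePreserving
      RandomTwist.lineMax_translate
      (hreg.mono fun ω hω => RandomTwist.continuous_lineMax hω.continuousOn) hc] with ω hω hωc
    exact hω.hasContinuum_of_lineMax_eq_const hωc
  by_cases hslope : ∀ᵐ ω ∂P, RandomTwist.lineSlope (RandomTwist.realization τ Kbar ω) 0 = 0
  · left
    filter_upwards [hreg, RandomTwist.ae_forall_line_eq hP.measurePreserving
      RandomTwist.lineSlope_translate
      (hreg.mono fun ω hω => RandomTwist.continuous_lineSlope hω.continuousOn_grad) hslope]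
      with ω hω hω₀
    exact hω.hasContinuum_of_lineSlope_eq_zero hω₀
  obtain ⟨γ, A, hvalley⟩ := hP.exists_ae_recurrent_isValley hK hconst
  obtain ⟨δ, hδ, hbarrier⟩ := hP.exists_ae_recurrent_isBarrier hK hslope
  right
  filter_upwards [hreg, hvalley, hbarrier] with ω hω hV hbar
  exact ⟨hω.infinite_isCriticalMax hV, hω.infinite_isSaddle_or_isCriticalMin hδ hV hbar⟩

theorem mainTheorem6 {Ω : Type*} [MetricSpace Ω] [TopologicalSpace.SeparableSpace Ω]
    [MeasurableSpace Ω] [BorelSpace Ω] (τ : Flow ℝ Ω) (P : Measure Ω)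
    (hP : RandomTwist.IsInvariantErgodic τ P)
    (Kbar : Ω → ℝ → ℝ) (hK : RandomTwist.IsC1 τ P Kbar)
    (htop : ∀ᵐ ω ∂P, ∀ q : ℝ, derivWithin (Kbar (τ q ω)) (Icc (-1) 1) 1 < 0)
    (hbot : ∀ᵐ ω ∂P, ∀ q : ℝ, 0 < derivWithin (Kbar (τ q ω)) (Icc (-1) 1) (-1)) :
    (∀ᵐ ω ∂P, {x | RandomTwist.IsCritical (RandomTwist.realization τ Kbar ω) x}.Infinite) ∧
    ((∀ᵐ ω ∂P, RandomTwist.HasContinuumOfCriticalPoints (RandomTwist.realization τ Kbar ω)) ∨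
      (∀ᵐ ω ∂P,
        {x | RandomTwist.IsCriticalMax (RandomTwist.realization τ Kbar ω) x}.Infinite ∧
        {x | (RandomTwist.IsSaddle (RandomTwist.realization τ Kbar ω) x ∨
            RandomTwist.IsCriticalMin (RandomTwist.realization τ Kbar ω) x) ∧
          ¬ RandomTwist.IsCriticalMax (RandomTwist.realization τ Kbar ω) x}.Infinite)) := by
  have : IsProbabilityMeasure P := ⟨hP.prob⟩
  exact mainTheorem6_general τ P hP.isErgodicFlow Kbar hK htop hbot
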